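/- Conventions. Let $d,q\in\mathbb N$ and let $\|\cdot\|$ denote arbitrary norms on $\mathbb R^d$ and on $\mathbb R^q$, extended to $[0,\infty]^d$ and $[0,\infty]^q$ by the value $\infty$ at vectors with an infinite entry. On $\mathcal E_d=[0,\infty]^d\setminus\{0\}$ use the topology inherited from $[0,\infty]^d$, so that the compact sets are the compact subsets of $[0,\infty]^d$ not containing $0$, and the Borel $\sigma$-algebra. Vague convergence $\xrightarrow{v}$ means convergence of the integrals of all continuous functions with compact support. A random vector $X$ in $[0,\infty)^d$ has intensity measure $\mu$ with respect to a relatively compact Borel set $D\subset\mathcal E_d$ if $\mu\not\equiv0$ is a Radon measure on $\mathcal E_d$ with $\mu([0,\infty]^d\setminus[0,\infty)^d)=0$, $\mu(\partial(tD))=0$ for all $t$ in a dense subset of $(0,\infty)$, and $$\frac{\mathbb P(X\in t\,\cdot)}{\mathbb P(X\in tD)}\xrightarrow{v}\mu(\cdot),\qquad t\to\infty .$$ A measure $\mu$ on $\mathcal E_d$ is homogeneous of order $-\alpha$ if $\mu(uS)=u^{-\alpha}\mu(S)$ for all $u>0$ and all Borel sets $S$. We write $X\in\mathcal R(-\alpha)$,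 $\alpha>0$, if for some such $D$ the vector $X$ has an intensity measure that is homogeneous of order $-\alpha$. **Proposition.** Let $\alpha>0$ and let $V=(V_1,\dots,V_d)^\top$ be a random vector in $[0,\infty)^d$ with Pareto tails: for each $j$, $\mathbb P(V_j>t)\sim K_jt^{-\alpha}$ as $t\to\infty$ for some $K_j>0$. Suppose that $V$ has an intensity measure $\mu$ with respect to $D=\{x\in\mathcal E_d:\|x\|>1\}$. Let $A$ be a random $q\times d$ matrix with nonnegative entries, independent of $V$, such that $\mathbb E A_{ij}^\alpha<\infty$ for all $i,j$ and $\mathbb P(A\neq0)>0$. Put $F=AV$, $C=\{x\in\mathcal E_q:\|x\|>1\}$ and, for Borel $B\subset\mathcal E_q$, $$\mathbb E\mu\circ A^{-1}(B)=\mathbb E\big[\mu(\{x\in\mathcal E_d: Ax\in B\})\big],\qquad 0\cdot\infty:=0 .$$ Then $F\in\mathcal R(-\alpha)$ and $0<\mathbb E\mu\circ A^{-1}(C)<\infty$. Moreover: (a) The intensity measure of $F$ with respect to $C$ is $$\overline\mu(\cdot)=\big(\mathbb E\mu\circ A^{-1}(C)\big)^{-1}\,\mathbb E\mu\circ A^{-1}(\cdot)\quad\text{on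 }\mathcal B(\mathcal E_q);$$ in particular $$\frac{\mathbb P(F\in t\,\cdot)}{\mathbb P(\|F\|>t)}\xrightarrow{v}\overline\mu(\cdot),\qquad t\to\infty,$$ and $\overline\mu(C)=1$. Moreover, $\overline\mu$ is homogeneous of order $-\alpha$. (b) On $\mathbb S_+^{q-1}=\{x\in[0,\infty)^q:\|x\|=1\}$ define $$\overline\rho(\cdot)=\big(\mathbb E\mu\circ A^{-1}(C)\big)^{-1}\,\mathbb E\mu\circ A^{-1}\Big(\Big\{x\in[0,\infty)^q:\|x\|>1,\ \frac{x}{\|x\|}\in\cdot\Big\}\Big).$$ Then $\overline\rho$ is a probability measure (the spectral measure of $F$), and for every $u>0$ $$\frac{\mathbb P(\|F\|>ut,\ F/\|F\|\in\cdot)}{\mathbb P(\|F\|>t)}\xrightarrow{v}u^{-\alpha}\,\overline\rho(\cdot),\qquad t\to\infty .$$ -/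

import Mathlib

open MeasureTheory ProbabilityTheory Filter Topology
open scoped ENNReal

noncomputable section

/-- The punctured compactified orthant `[0,∞]^d \ {0}`. As an open subspace of the compact space
`[0,∞]^d`, its compact sets are exactly the compact subsets of `[0,∞]^d` that do not contain `0`;
its measurable sets are the Borel sets. -/
abbrev PuncturedOrthant (d : ℕ) : Type := {x : Fin d → ℝ≥0∞ // x ≠ 0}

/-- Vague convergence `ν i → ν₀` along the filter `l`: convergence of the integrals of all
continuous real functions with compact support. -/
def VagueTendsto {T ι : Type*} [TopologicalSpace T] [MeasurableSpace T]
    (l : Filter ι) (ν : ι → Measure T) (ν₀ : Measure T) : Prop :=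
  ∀ f : T → ℝ, Continuous f → HasCompactSupport f →
    Tendsto (fun i => ∫ x, f x ∂(ν i)) l (𝓝 (∫ x, f x ∂ν₀))

/-- For a random vector `X` with nonnegative entries and `t > 0`, the measure
`S ↦ P (X ∈ t S)` on `[0,∞]^d \ {0}`. -/
def scaledLaw {Ω : Type*} [MeasurableSpace Ω] (P : Measure Ω) {d : ℕ}
    (X : Ω → Fin d → ℝ) (t : ℝ) : Measure (PuncturedOrthant d) :=
  (P.map (fun ω i => ENNReal.ofReal (X ω i / t))).comap Subtype.val

/-- The dilated set `u S = {u y : y ∈ S}` (used for `u > 0`). -/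
def dilate {d : ℕ} (u : ℝ) (S : Set (PuncturedOrthant d)) : Set (PuncturedOrthant d) :=
  {x | ∃ y ∈ S, ∀ i, x.1 i = ENNReal.ofReal u * y.1 i}

/-- Homogeneity of order `-α`: `μ (u S) = u ^ (-α) μ (S)` for all `u > 0` and Borel sets `S`. -/
def IsHomogeneous {d : ℕ} (μ : Measure (PuncturedOrthant d)) (α : ℝ) : Prop :=
  ∀ u : ℝ, 0 < u → ∀ S : Set (PuncturedOrthant d), MeasurableSet S →
    μ (dilate u S) = ENNReal.ofReal (u ^ (-α)) * μ S

/-- `μ` is the intensity measure of the random vector `X` with respect to the relatively compact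
Borel set `D`: a nonzero Radon measure without mass at infinity such that the boundaries of `t D`
are `μ`-null for a dense set of `t > 0` and `P (X ∈ t ·) / P (X ∈ t D) → μ` vaguely. (Finiteness on
compact sets is the Radon property on this locally compact, second countable space.) -/
structure IsIntensityMeasure {Ω : Type*} [MeasurableSpace Ω] (P : Measure Ω) {d : ℕ}
    (X : Ω → Fin d → ℝ) (D : Set (PuncturedOrthant d)) (μ : Measure (PuncturedOrthant d)) :
    Prop where
  measurableSet : MeasurableSet D
  relativelyCompact : IsCompact (closure D)
  radon : IsFiniteMeasureOnCompacts μ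
  ne_zero : μ ≠ 0
  infinity_null : μ {x | ∃ i, x.1 i = ∞} = 0
  boundary_null : ∃ T : Set ℝ, T ⊆ Set.Ioi 0 ∧ Set.Ioi 0 ⊆ closure T ∧
    ∀ t ∈ T, μ (frontier (dilate t D)) = 0
  tendsto : VagueTendsto atTop (fun t : ℝ => (scaledLaw P X t D)⁻¹ • scaledLaw P X t) μ

/-- Multivariate regular variation with index `α > 0`, i.e. `X ∈ R(-α)`. -/
def IsRegularlyVarying {Ω : Type*} [MeasurableSpace Ω] (P : Measure Ω) {d : ℕ}
    (X : Ω → Fin d → ℝ) (α : ℝ) : Prop :=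
  0 < α ∧ ∃ (D : Set (PuncturedOrthant d)) (μ : Measure (PuncturedOrthant d)),
    IsIntensityMeasure P X D μ ∧ IsHomogeneous μ α

/-- The extension of the function `N` (a norm) from `[0,∞)^d` to `[0,∞]^d`, with value `∞` at the
vectors that have an infinite entry. -/
def extNorm {d : ℕ} (N : Seminorm ℝ (Fin d → ℝ)) (x : Fin d → ℝ≥0∞) : ℝ≥0∞ :=
  open Classical in
  if ∃ i, x i = ∞ then ∞ else ENNReal.ofReal (N (fun i => (x i).toReal))

/-- The set `{x ∈ [0,∞]^d : ‖x‖ > 1}`. -/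
def outerCone {d : ℕ} (N : Seminorm ℝ (Fin d → ℝ)) : Set (PuncturedOrthant d) :=
  {x | 1 < extNorm N x.1}

/-- The product `M x` for a matrix `M` with nonnegative entries and `x ∈ [0,∞]^d`
(with `0 * ∞ = 0`). -/
def extMulVec {q d : ℕ} (M : Fin q → Fin d → ℝ) (x : Fin d → ℝ≥0∞) : Fin q → ℝ≥0∞ :=
  fun i => ∑ j, ENNReal.ofReal (M i j) * x j

/-- The set function `E μ ∘ A⁻¹`: the expectation of `μ {x : A x ∈ B}`. -/
def meanImage {Ω : Type*} [MeasurableSpace Ω] (P : Measure Ω) {q d : ℕ}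
    (A : Ω → Fin q → Fin d → ℝ) (μ : Measure (PuncturedOrthant d))
    (B : Set (PuncturedOrthant q)) : ℝ≥0∞ :=
  ∫⁻ ω, μ {x | extMulVec (A ω) x.1 ∈ Subtype.val '' B} ∂P

/-- The positive part of the unit sphere, `{x ∈ [0,∞)^q : ‖x‖ = 1}`. -/
abbrev PosSphere {q : ℕ} (N : Seminorm ℝ (Fin q → ℝ)) : Type :=
  {x : Fin q → ℝ // (∀ i, 0 ≤ x i) ∧ N x = 1}

/-- The measure `B ↦ P (‖X‖ > s, X / ‖X‖ ∈ B)` on the positive part of the unit sphere. -/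
def angularLaw {Ω : Type*} [MeasurableSpace Ω] (P : Measure Ω) {q : ℕ}
    (N : Seminorm ℝ (Fin q → ℝ)) (X : Ω → Fin q → ℝ) (s : ℝ) : Measure (PosSphere N) :=
  ((P.restrict {ω | s < N (X ω)}).map (fun ω => (N (X ω))⁻¹ • X ω)).comap Subtype.val

/-- The set `{x : ‖x‖ > 1, x / ‖x‖ ∈ B}`, consisting of vectors with finite entries. -/
def coneOver {q : ℕ} (N : Seminorm ℝ (Fin q → ℝ)) (B : Set (PosSphere N)) :
    Set (PuncturedOrthant q) :=
  {x | (∀ i, x.1 i ≠ ∞) ∧ 1 < extNorm N x.1 ∧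
    (N (fun i => (x.1 i).toReal))⁻¹ • (fun i => (x.1 i).toReal) ∈ Subtype.val '' B}

end

/-! The theorem is a multivariate Breiman lemma, proved after replacing the given normalization by a
power of `t`.

Since μ ≠ 0, some set {x_j > s} has positive μ-mass and a μ-null boundary. Comparing its limiting
mass with the Pareto tail of V_j shows that t^α P(V ∈ t·) converges vaguely to cμ for some c > 0
(`exists_vagueTendsto_rescaledLaw`). A vague limit under power normalization is automatically
homogeneous, because passing from t to t/u only produces a factor u^α
(`isHomogeneous_of_vagueTendsto`).

For F = AV, independence allows A to be frozen. For a fixed matrix a, a test function composed with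
x ↦ ax is again a test function, so the inner expectation converges. The Pareto bounds dominate it,
uniformly in t, by a linear combination of the a_ij^α, which is integrable by the moment assumption.
Dominated convergence gives t^α P(F ∈ t·) → E(cμ) ∘ A⁻¹ (`vagueTendsto_rescaledLaw_mulVec`). Every
coordinate half-space has positive cμ-mass by its own Pareto tail, so A ≠ 0 with positive
probability makes the limit charge {‖x‖ > 1} (`meanMeasure_outerCone_ne_zero`).

Homogeneity of the limit makes norm spheres and the points at infinity null. Hence P(‖F‖ > t) and
the angular laws converge by a portmanteau argument for functions continuous off a null set
(`VagueTendsto.tendsto_integral_of_continuousAt`), and c cancels on normalizing. -/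

/-! ### Portmanteau arguments for vague convergence -/

section Portmanteau

variable {T : Type*} [TopologicalSpace T] [MeasurableSpace T] [BorelSpace T]

/-- A continuous cutoff equal to 1 on the support of g, multiplied by M, is an integrable majorant.
This serves test functions with jumps. -/
theorem integrable_of_bound_of_hasCompactSupport [R1Space T] [LocallyCompactSpace T]
    {ν : Measure T} [IsFiniteMeasureOnCompacts ν] {g : T → ℝ} (hg : Measurable g)
    (hgs : HasCompactSupport g) {M : ℝ} (hM : ∀ x, |g x| ≤ M) : Integrable g ν := by
  obtain ⟨κ, hκ1, -, hκs, hκ⟩ := exists_continuous_one_zero_of_isCompact (t := ∅)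
    (show IsCompact (tsupport g) from hgs) isClosed_empty (Set.disjoint_empty _)
  have hκi : Integrable (fun x => M * κ x) ν :=
    (κ.continuous.integrable_of_hasCompactSupport hκs).const_mul M
  refine hκi.mono' hg.aestronglyMeasurable (ae_of_all _ fun x => ?_)
  rw [Real.norm_eq_abs]
  by_cases hx : x ∈ tsupport g
  · simpa [hκ1 hx] using hM x
  · rw [image_eq_zero_of_notMem_tsupport hx, abs_zero]
    exact mul_nonneg ((abs_nonneg _).trans (hM x)) (hκ x).1

/-- If a function can be squeezed by continuous compactly supported functions up to arbitrarily
small error, then its integrals converge along vaguely converging measures. -/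
theorem VagueTendsto.tendsto_integral_of_approx {ι : Type*} {l : Filter ι} {ν : ι → Measure T}
    {ν₀ : Measure T} (h : VagueTendsto l ν ν₀)
    [∀ i, IsFiniteMeasureOnCompacts (ν i)] [IsFiniteMeasureOnCompacts ν₀] {g : T → ℝ}
    (hgi : ∀ i, Integrable g (ν i)) (hgi₀ : Integrable g ν₀)
    (happrox : ∀ ε : ℝ, 0 < ε → ∃ f k : T → ℝ, Continuous f ∧ HasCompactSupport f ∧
      Continuous k ∧ HasCompactSupport k ∧ (∀ x, |g x - f x| ≤ k x) ∧ ∫ x, k x ∂ν₀ < ε) :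
    Tendsto (fun i => ∫ x, g x ∂(ν i)) l (𝓝 (∫ x, g x ∂ν₀)) := by
  rw [Metric.tendsto_nhds]
  intro ε hε
  -- Three errors: g versus f under ν i, f under ν i versus ν₀, and f versus g under ν₀. The first
  -- and last are bounded by the integrals of k.
  obtain ⟨f, k, hf, hfs, hk, hks, hfk, hkε⟩ := happrox (ε / 3) (by positivity)
  have key : ∀ m : Measure T, IsFiniteMeasureOnCompacts m → Integrable g m →
      |∫ x, g x ∂m - ∫ x, f x ∂m| ≤ ∫ x, k x ∂m := by
    intro m _ hgm
    rw [← integral_sub hgm (hf.integrable_of_hasCompactSupport hfs)]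
    refine abs_integral_le_integral_abs.trans ?_
    exact integral_mono (hgm.sub (hf.integrable_of_hasCompactSupport hfs)).abs
      (hk.integrable_of_hasCompactSupport hks) hfk
  have h1 := (Metric.tendsto_nhds.1 (h f hf hfs)) (ε / 3) (by positivity)
  have h2 := (h k hk hks).eventually_lt_const hkε
  filter_upwards [h1, h2] with i hi1 hi2
  rw [Real.dist_eq] at hi1 ⊢
  have e1 := key (ν i) inferInstance (hgi i)
  have e2 := key ν₀ inferInstance hgi₀
  rw [abs_lt] at hi1 ⊢
  rw [abs_le] at e1 e2
  constructor <;> linarith [hi1.1, hi1.2, e1.1, e1.2, e2.1, e2.2]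

/-- Bounded compactly supported functions that are continuous off a closed null set have
converging integrals along vaguely converging measures. -/
theorem VagueTendsto.tendsto_integral_of_continuousAt [T2Space T] [LocallyCompactSpace T]
    [HasOuterApproxClosed T] {ι : Type*} {l : Filter ι} {ν : ι → Measure T}
    {ν₀ : Measure T} (h : VagueTendsto l ν ν₀)
    [∀ i, IsFiniteMeasureOnCompacts (ν i)] [IsFiniteMeasureOnCompacts ν₀] {g : T → ℝ}
    (hg : Measurable g) (hgs : HasCompactSupport g) {M : ℝ} (hM : ∀ x, |g x| ≤ M)
    {Z : Set T} (hZ : IsClosed Z) (hZ0 : ν₀ Z = 0) (hgc : ∀ x ∉ Z, ContinuousAt g x) :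
    Tendsto (fun i => ∫ x, g x ∂(ν i)) l (𝓝 (∫ x, g x ∂ν₀)) := by
  refine h.tendsto_integral_of_approx
    (fun i => integrable_of_bound_of_hasCompactSupport hg hgs hM)
    (integrable_of_bound_of_hasCompactSupport hg hgs hM) fun ε hε => ?_
  obtain ⟨κ, hκ1, -, hκs, hκ⟩ := exists_continuous_one_zero_of_isCompact (t := ∅)
    (show IsCompact (tsupport g) from hgs) isClosed_empty (Set.disjoint_empty _)
  set a : ℕ → T → ℝ := fun n x => (hZ.apprSeq n x : ℝ) with ha
  have hac : ∀ n, Continuous (a n) := fun n =>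
    NNReal.continuous_coe.comp (hZ.apprSeq n).continuous
  have ha0 : ∀ n x, 0 ≤ a n x := fun n x => NNReal.coe_nonneg _
  have ha1 : ∀ n x, a n x ≤ 1 := fun n x =>
    NNReal.coe_le_one.2 (HasOuterApproxClosed.apprSeq_apply_le_one hZ n x)
  have haZ : ∀ n, ∀ x ∈ Z, a n x = 1 := fun n x hx => by
    simp [ha, HasOuterApproxClosed.apprSeq_apply_eq_one hZ n hx]
  have hlim : Tendsto (fun n => ∫ x, M * (κ x * a n x) ∂ν₀) atTop (𝓝 0) := by
    have hκi : Integrable (fun x => |M| * κ x) ν₀ :=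
      (κ.continuous.integrable_of_hasCompactSupport hκs).const_mul _
    have : Tendsto (fun n => ∫ x, M * (κ x * a n x) ∂ν₀) atTop (𝓝 (∫ _, (0 : ℝ) ∂ν₀)) := by
      refine tendsto_integral_of_dominated_convergence _
        (fun n => ((κ.continuous.mul (hac n)).const_smul M).measurable.aestronglyMeasurable) hκi
        (fun n => ae_of_all _ fun x => ?_) ?_
      · rw [Real.norm_eq_abs, abs_mul, abs_mul, abs_of_nonneg (hκ x).1, abs_of_nonneg (ha0 n x)]
        exact mul_le_mul_of_nonneg_left (mul_le_of_le_one_right (hκ x).1 (ha1 n x)) (abs_nonneg _)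
      · have hae : ∀ᵐ x ∂ν₀, x ∉ Z := measure_eq_zero_iff_ae_notMem.1 hZ0
        filter_upwards [hae] with x hx
        have h1 := tendsto_pi_nhds.1 (HasOuterApproxClosed.tendsto_apprSeq hZ) x
        rw [Set.indicator_of_notMem hx] at h1
        have h2 : Tendsto (fun n => a n x) atTop (𝓝 0) := by
          simpa using (NNReal.tendsto_coe.2 h1)
        simpa using (h2.const_mul (κ x)).const_mul M
    simpa using this
  obtain ⟨n, hn⟩ := (hlim.eventually_lt_const hε).exists
  -- The factor 1 - a n vanishes on Z and so removes the discontinuities of g. The error g · a n is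
  -- at most M κ (a n), whose ν₀-integral is small because a n decreases to the indicator of a null
  -- set.
  refine ⟨fun x => g x * (1 - a n x), fun x => M * (κ x * a n x), ?_, hgs.mul_right,
    by have := hac n; fun_prop, (hκs.mul_right).mul_left, fun x => ?_, hn⟩
  · rw [continuous_iff_continuousAt]
    intro x
    by_cases hx : x ∈ Z
    · have h0 : Tendsto (fun y => M * (1 - a n y)) (𝓝 x) (𝓝 0) := by
        have hc : Continuous fun y => M * (1 - a n y) := by have := hac n; fun_prop
        have := hc.tendsto x
        rwa [haZ n x hx, sub_self, mul_zero] at this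
      have hx0 : g x * (1 - a n x) = 0 := by rw [haZ n x hx, sub_self, mul_zero]
      change Tendsto _ _ (𝓝 (g x * (1 - a n x)))
      rw [hx0]
      refine squeeze_zero_norm (fun y => ?_) h0
      rw [Real.norm_eq_abs, abs_mul, abs_of_nonneg (sub_nonneg.2 (ha1 n y))]
      exact mul_le_mul_of_nonneg_right (hM y) (sub_nonneg.2 (ha1 n y))
    · exact (hgc x hx).mul (continuousAt_const.sub (hac n).continuousAt)
  · have : g x - g x * (1 - a n x) = g x * a n x := by ring
    rw [this, abs_mul, abs_of_nonneg (ha0 n x)]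
    change _ ≤ M * (κ x * a n x)
    rw [← mul_assoc]
    refine mul_le_mul_of_nonneg_right ?_ (ha0 n x)
    by_cases hx : x ∈ tsupport g
    · simpa [hκ1 hx] using hM x
    · rw [image_eq_zero_of_notMem_tsupport hx, abs_zero]
      exact mul_nonneg ((abs_nonneg _).trans (hM x)) (hκ x).1

end Portmanteau

/-! ### Compactness and dilations in the punctured orthant -/

section Topology

variable {d : ℕ}

theorem isOpen_ne_zero : IsOpen {x : Fin d → ℝ≥0∞ | x ≠ 0} := isOpen_ne

instance : SecondCountableTopology (PuncturedOrthant d) :=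
  TopologicalSpace.Subtype.secondCountableTopology {x : Fin d → ℝ≥0∞ | x ≠ 0}

instance : LocallyCompactSpace (PuncturedOrthant d) :=
  isOpen_ne_zero.locallyCompactSpace

instance : HasOuterApproxClosed (PuncturedOrthant d) := by
  let _ := TopologicalSpace.metrizableSpaceMetric (PuncturedOrthant d)
  infer_instance

/-- The sum of the entries of a vector in `[0,∞]^d`. -/
noncomputable def entrySum (x : Fin d → ℝ≥0∞) : ℝ≥0∞ := ∑ i, x i

theorem continuous_entrySum : Continuous (entrySum : (Fin d → ℝ≥0∞) → ℝ≥0∞) :=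
  continuous_finsetSum _ fun i _ => continuous_apply i

theorem entrySum_eq_zero {x : Fin d → ℝ≥0∞} : entrySum x = 0 ↔ x = 0 := by
  simp [entrySum, funext_iff]

/-- The superlevel set is closed in the compact space `[0,∞]^d` and avoids 0 because ψ vanishes
there. Points at infinity are included, which is what makes it compact. -/
theorem isCompact_le_of_continuous {ψ : (Fin d → ℝ≥0∞) → ℝ≥0∞} (hψ : Continuous ψ)
    (h0 : ψ 0 = 0) {δ : ℝ≥0∞} (hδ : 0 < δ) :
    IsCompact {x : PuncturedOrthant d | δ ≤ ψ x.1} := by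
  rw [Subtype.isCompact_iff]
  have : Subtype.val '' {x : PuncturedOrthant d | δ ≤ ψ x.1} = {x | δ ≤ ψ x} := by
    ext x
    simp only [Set.mem_image, Set.mem_ofPred_eq, Subtype.exists, exists_and_left, exists_prop,
      exists_eq_right_right, and_iff_left_iff_imp]
    rintro hx rfl
    rw [h0] at hx
    exact hδ.not_ge hx
  rw [this]
  exact (isClosed_le continuous_const hψ).isCompact

/-- The entry sum is continuous and positive away from 0, so it has a positive minimum on S. It
serves as the gauge of distance from 0, independent of any norm. -/
theorem exists_le_entrySum_of_isCompact {S : Set (PuncturedOrthant d)} (hS : IsCompact S) :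
    ∃ δ : ℝ, 0 < δ ∧ ∀ x ∈ S, ENNReal.ofReal δ ≤ entrySum x.1 := by
  rcases S.eq_empty_or_nonempty with rfl | hne
  · exact ⟨1, one_pos, by simp⟩
  obtain ⟨x, -, hx⟩ := hS.exists_isMinOn hne
    (continuous_entrySum.comp continuous_subtype_val).continuousOn
  have hpos : 0 < entrySum x.1 := pos_iff_ne_zero.2 fun h => x.2 (entrySum_eq_zero.1 h)
  obtain ⟨δ, hδ0, hδ⟩ := ENNReal.lt_iff_exists_real_btwn.1 hpos
  refine ⟨δ, ENNReal.ofReal_pos.1 hδ.1, fun y hy => hδ.2.le.trans (hx hy)⟩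

theorem hasCompactSupport_of_le_entrySum {g : PuncturedOrthant d → ℝ}
    {ψ : (Fin d → ℝ≥0∞) → ℝ≥0∞} (hψ : Continuous ψ) (h0 : ψ 0 = 0) {δ : ℝ≥0∞} (hδ : 0 < δ)
    (hg : ∀ x, ψ x.1 < δ → g x = 0) : HasCompactSupport g :=
  HasCompactSupport.intro (isCompact_le_of_continuous hψ h0 hδ) fun x hx => hg x (not_le.1 hx)

/-- A continuous compactly supported function on the punctured orthant is the restriction of
a bounded continuous function on `[0,∞]^d` that vanishes near `0`. -/
theorem exists_extension_of_hasCompactSupport {f : PuncturedOrthant d → ℝ} (hf : Continuous f)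
    (hfs : HasCompactSupport f) : ∃ g : (Fin d → ℝ≥0∞) → ℝ, Continuous g ∧
      (∀ x : PuncturedOrthant d, g x.1 = f x) ∧
      (∃ M : ℝ, ∀ x, |g x| ≤ M) ∧
      ∃ δ : ℝ, 0 < δ ∧ ∀ x, entrySum x < ENNReal.ofReal δ → g x = 0 := by
  set g : (Fin d → ℝ≥0∞) → ℝ := Function.extend Subtype.val f 0 with hg
  have hgf : ∀ x : PuncturedOrthant d, g x.1 = f x := fun x =>
    Subtype.val_injective.extend_apply f 0 x
  have hgc : Continuous g := HasCompactSupport.continuous_extend_zero isOpen_ne_zero hf hfs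
  obtain ⟨M, hM⟩ := isCompact_univ.exists_bound_of_continuousOn hgc.continuousOn
  obtain ⟨δ, hδ0, hδ⟩ := exists_le_entrySum_of_isCompact hfs
  refine ⟨g, hgc, hgf, ⟨M, fun x => hM x trivial⟩, δ, hδ0, fun x hx => ?_⟩
  by_cases h0 : x = 0
  · have : ¬ ∃ a : PuncturedOrthant d, a.1 = x := by
      rintro ⟨a, ha⟩
      exact a.2 (ha.trans h0)
    rw [hg, Function.extend_apply' _ _ _ this]
    rfl
  · rw [show x = (⟨x, h0⟩ : PuncturedOrthant d).1 from rfl, hgf]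
    by_contra hne
    exact (hδ ⟨x, h0⟩ (subset_tsupport f hne)).not_gt hx

/-- The coefficients are finite, so each multiplication is continuous even at ∞; a zero coefficient
gives the constant 0. -/
theorem continuous_extMulVec {q : ℕ} (M : Fin q → Fin d → ℝ) : Continuous (extMulVec M) :=
  continuous_pi fun _ => continuous_finsetSum _ fun j _ =>
    (ENNReal.continuous_const_mul ENNReal.ofReal_ne_top).comp (continuous_apply j)

theorem extMulVec_zero {q : ℕ} (M : Fin q → Fin d → ℝ) : extMulVec M 0 = 0 := by
  ext i; simp [extMulVec]

/-- The dilation `x ↦ u x` of the punctured orthant. -/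
noncomputable def dilateHomeomorph (d : ℕ) (u : ℝ) (hu : 0 < u) : PuncturedOrthant d ≃ₜ PuncturedOrthant d :=
  have aux : ∀ v : ℝ, 0 < v → ∀ x : PuncturedOrthant d,
      (fun i => ENNReal.ofReal v * x.1 i) ≠ 0 := fun v hv x h => x.2 (by
    ext i
    have := congrFun h i
    simpa [hv.not_ge] using this)
  have inv : ∀ v w : ℝ, 0 < v → 0 < w → v * w = 1 → ∀ y : ℝ≥0∞,
      ENNReal.ofReal v * (ENNReal.ofReal w * y) = y := fun v w hv hw h y => by
    rw [← mul_assoc, ← ENNReal.ofReal_mul hv.le, h, ENNReal.ofReal_one, one_mul]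
  have cont : ∀ v : ℝ, ∀ hv : 0 < v, Continuous fun x : PuncturedOrthant d =>
      (⟨fun i => ENNReal.ofReal v * x.1 i, aux v hv x⟩ : PuncturedOrthant d) := fun v hv =>
    Continuous.subtype_mk (continuous_pi fun i =>
      (ENNReal.continuous_const_mul ENNReal.ofReal_ne_top).comp
        ((continuous_apply i).comp continuous_subtype_val)) _
  { toFun := fun x => ⟨fun i => ENNReal.ofReal u * x.1 i, aux u hu x⟩
    invFun := fun x => ⟨fun i => ENNReal.ofReal u⁻¹ * x.1 i, aux u⁻¹ (inv_pos.2 hu) x⟩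
    left_inv := fun x => by
      ext i
      exact inv u⁻¹ u (inv_pos.2 hu) hu (inv_mul_cancel₀ hu.ne') _
    right_inv := fun x => by
      ext i
      exact inv u u⁻¹ hu (inv_pos.2 hu) (mul_inv_cancel₀ hu.ne') _
    continuous_toFun := cont u hu
    continuous_invFun := cont u⁻¹ (inv_pos.2 hu) }

theorem dilateHomeomorph_apply {u : ℝ} (hu : 0 < u) (x : PuncturedOrthant d) :
    (dilateHomeomorph d u hu x).1 = fun i => ENNReal.ofReal u * x.1 i := rfl

theorem dilate_eq_image {u : ℝ} (hu : 0 < u) (S : Set (PuncturedOrthant d)) :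
    dilate u S = dilateHomeomorph d u hu '' S := by
  ext x
  simp only [dilate, Set.mem_ofPred_eq, Set.mem_image]
  refine exists_congr fun y => and_congr_right fun _ => ?_
  rw [Subtype.ext_iff, dilateHomeomorph_apply, funext_iff]
  exact forall_congr' fun i => eq_comm

end Topology

/-! ### Norms extended to the compactified orthant -/

section Norm

variable {d : ℕ} (N : Seminorm ℝ (Fin d → ℝ))

theorem Seminorm.continuous_pi_fin : Continuous N := by
  have := N.convexOn.continuousOn isOpen_univ
  exact continuousOn_univ.1 this

variable {N}

/-- The constant is the minimum of N on the unit sphere of the sup norm, positive by definiteness.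
An empty sphere leaves no index i to check. -/
theorem Seminorm.exists_mul_abs_le (hN : ∀ x, N x = 0 → x = 0) :
    ∃ m : ℝ, 0 < m ∧ ∀ x i, m * |x i| ≤ N x := by
  rcases (Metric.sphere (0 : Fin d → ℝ) 1).eq_empty_or_nonempty with he | hne
  · refine ⟨1, one_pos, fun x i => ?_⟩
    exfalso
    have : (Pi.single i 1 : Fin d → ℝ) ∈ Metric.sphere (0 : Fin d → ℝ) 1 := by
      simp [Pi.norm_single]
    rw [he] at this
    exact this
  · obtain ⟨y, hy, hmin⟩ := (isCompact_sphere (0 : Fin d → ℝ) 1).exists_isMinOn hne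
      N.continuous_pi_fin.continuousOn
    have hy1 : ‖y‖ = 1 := by simpa using hy
    refine ⟨N y, (apply_nonneg N y).lt_of_ne fun h => ?_, fun x i => ?_⟩
    · rw [hN y h.symm, norm_zero] at hy1
      exact zero_ne_one hy1
    · refine (mul_le_mul_of_nonneg_left (norm_le_pi_norm x i) (apply_nonneg N y)).trans ?_
      by_cases hx : x = 0
      · simp [hx]
      have hx' : 0 < ‖x‖ := norm_pos_iff.2 hx
      have h1 : ‖x‖⁻¹ • x ∈ Metric.sphere (0 : Fin d → ℝ) 1 := by
        simp [norm_smul, hx'.ne']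
      have h2 : N y ≤ N (‖x‖⁻¹ • x) := hmin h1
      rw [map_smul_eq_mul, norm_inv, norm_norm, inv_mul_eq_div, le_div_iff₀ hx'] at h2
      exact h2

theorem extNorm_of_ne_top {x : Fin d → ℝ≥0∞} (hx : ∀ i, x i ≠ ∞) :
    extNorm N x = ENNReal.ofReal (N fun i => (x i).toReal) := by
  rw [extNorm, if_neg (by simpa using hx)]

theorem extNorm_of_eq_top {x : Fin d → ℝ≥0∞} {i : Fin d} (hx : x i = ∞) :
    extNorm N x = ∞ := by
  rw [extNorm, if_pos ⟨i, hx⟩]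

theorem extNorm_eq_top {x : Fin d → ℝ≥0∞} : extNorm N x = ∞ ↔ ∃ i, x i = ∞ := by
  refine ⟨fun h => ?_, fun ⟨i, hi⟩ => extNorm_of_eq_top hi⟩
  by_contra! hc
  rw [extNorm_of_ne_top hc] at h
  exact ENNReal.ofReal_ne_top h

theorem extNorm_zero : extNorm N 0 = 0 := by
  rw [extNorm_of_ne_top (by simp)]
  have : (fun i : Fin d => ((0 : Fin d → ℝ≥0∞) i).toReal) = 0 := by ext; simp
  rw [this, map_zero, ENNReal.ofReal_zero]

theorem extNorm_ofReal {x : Fin d → ℝ} (hx : ∀ i, 0 ≤ x i) :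
    extNorm N (fun i => ENNReal.ofReal (x i)) = ENNReal.ofReal (N x) := by
  rw [extNorm_of_ne_top (by simp)]
  simp [ENNReal.toReal_ofReal (hx _)]

theorem extNorm_mul {u : ℝ} (hu : 0 < u) (x : Fin d → ℝ≥0∞) :
    extNorm N (fun i => ENNReal.ofReal u * x i) = ENNReal.ofReal u * extNorm N x := by
  have hu0 : ENNReal.ofReal u ≠ 0 := by simpa using hu
  by_cases hx : ∃ i, x i = ∞
  · obtain ⟨i, hi⟩ := hx
    rw [extNorm_of_eq_top hi, extNorm_of_eq_top (i := i) (by rw [hi, ENNReal.mul_top hu0]),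
      ENNReal.mul_top hu0]
  · push Not at hx
    rw [extNorm_of_ne_top hx, extNorm_of_ne_top fun i =>
      ENNReal.mul_ne_top ENNReal.ofReal_ne_top (hx i), ← ENNReal.ofReal_mul hu.le]
    congr 1
    have : (fun i => (ENNReal.ofReal u * x i).toReal) = u • fun i => (x i).toReal := by
      ext i
      simp [ENNReal.toReal_mul, ENNReal.toReal_ofReal hu.le]
    rw [this, map_smul_eq_mul, Real.norm_of_nonneg hu.le]

theorem exists_mul_le_extNorm (hN : ∀ x, N x = 0 → x = 0) :
    ∃ m : ℝ, 0 < m ∧ ∀ x i, ENNReal.ofReal m * x i ≤ extNorm N x := by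
  obtain ⟨m, hm, h⟩ := Seminorm.exists_mul_abs_le hN
  refine ⟨m, hm, fun x i => ?_⟩
  by_cases hx : ∃ i, x i = ∞
  · obtain ⟨j, hj⟩ := hx
    rw [extNorm_of_eq_top hj]
    exact le_top
  · push Not at hx
    rw [extNorm_of_ne_top hx, ← ENNReal.ofReal_toReal (hx i), ← ENNReal.ofReal_mul hm.le]
    refine ENNReal.ofReal_le_ofReal ?_
    have := h (fun i => (x i).toReal) i
    rwa [abs_of_nonneg ENNReal.toReal_nonneg] at this

theorem continuousAt_toReal_pi {x : Fin d → ℝ≥0∞} (hx : ∀ i, x i ≠ ∞) :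
    ContinuousAt (fun y : Fin d → ℝ≥0∞ => fun i => (y i).toReal) x :=
  continuousAt_pi.2 fun i => (ENNReal.continuousAt_toReal (hx i)).comp
    (f := fun y : Fin d → ℝ≥0∞ => y i) (continuous_apply i).continuousAt

/-- At finite points this is continuity of N. At points with an infinite entry, the lower bound by a
multiple of that entry forces the norm to ∞. -/
theorem continuous_extNorm (hN : ∀ x, N x = 0 → x = 0) : Continuous (extNorm N) := by
  rw [continuous_iff_continuousAt]
  intro x
  by_cases hx : ∃ i, x i = ∞
  · obtain ⟨i, hi⟩ := hx
    obtain ⟨m, hm, h⟩ := exists_mul_le_extNorm hN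
    have hm0 : ENNReal.ofReal m ≠ 0 := by simpa using hm
    unfold ContinuousAt
    rw [extNorm_of_eq_top hi]
    refine tendsto_nhds_top_mono' (f := fun y : Fin d → ℝ≥0∞ => ENNReal.ofReal m * y i) ?_
      fun y => h y i
    have := ((ENNReal.continuous_const_mul (a := ENNReal.ofReal m) ENNReal.ofReal_ne_top).comp
      (continuous_apply i)).tendsto x
    simpa [Function.comp_def, hi, ENNReal.mul_top hm0] using this
  · push Not at hx
    have ho : IsOpen {y : Fin d → ℝ≥0∞ | ∀ i, y i ≠ ∞} := by
      simp only [Set.ofPred_forall]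
      exact isOpen_iInter_of_finite fun i => isOpen_ne.preimage (continuous_apply i)
    have hc : ContinuousAt (fun y : Fin d → ℝ≥0∞ => ENNReal.ofReal (N fun i => (y i).toReal)) x :=
      (ENNReal.continuous_ofReal.comp N.continuous_pi_fin).continuousAt.comp
        (continuousAt_toReal_pi hx)
    refine hc.congr ?_
    filter_upwards [ho.mem_nhds hx] with y hy
    exact (extNorm_of_ne_top hy).symm

theorem isOpen_outerCone (hN : ∀ x, N x = 0 → x = 0) : IsOpen (outerCone N) :=
  isOpen_lt continuous_const ((continuous_extNorm hN).comp continuous_subtype_val)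

theorem isCompact_closure_outerCone (hN : ∀ x, N x = 0 → x = 0) :
    IsCompact (closure (outerCone N)) := by
  have h := isCompact_le_of_continuous (continuous_extNorm hN) extNorm_zero one_pos
  exact h.of_isClosed_subset isClosed_closure
    (closure_minimal (fun x (hx : 1 < extNorm N x.1) => hx.le) h.isClosed)

theorem frontier_dilate_outerCone_subset (hN : ∀ x, N x = 0 → x = 0) {t : ℝ} (ht : 0 < t) :
    frontier (dilate t (outerCone N)) ⊆ {x | extNorm N x.1 = ENNReal.ofReal t} := by
  rw [dilate_eq_image ht, ← Homeomorph.image_frontier]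
  rintro _ ⟨y, hy, rfl⟩
  have h1 : extNorm N y.1 = 1 :=
    (frontier_lt_subset_eq continuous_const
      ((continuous_extNorm hN).comp continuous_subtype_val) hy).symm
  rw [Set.mem_ofPred_eq, dilateHomeomorph_apply, extNorm_mul ht, h1, mul_one]

end Norm

/-! ### Scaled laws as measures on the punctured orthant -/

section ScaledLaw

variable {Ω : Type*} [MeasurableSpace Ω] {P : Measure Ω} {d : ℕ}
  {X : Ω → Fin d → ℝ}

theorem measurable_scaled (hX : Measurable X) (t : ℝ) :
    Measurable fun ω i => ENNReal.ofReal (X ω i / t) :=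
  measurable_pi_lambda _ fun i =>
    (((measurable_pi_apply i).comp hX).div_const t).ennreal_ofReal

theorem scaledLaw_preimage (hX : Measurable X) (t : ℝ) {B : Set (Fin d → ℝ≥0∞)}
    (hB : MeasurableSet B) (h0 : 0 ∉ B) :
    scaledLaw P X t {x | x.1 ∈ B} = P {ω | (fun i => ENNReal.ofReal (X ω i / t)) ∈ B} := by
  have h1 : (Subtype.val '' {x : PuncturedOrthant d | x.1 ∈ B}) = B := by
    ext x
    constructor
    · rintro ⟨y, hy, rfl⟩
      exact hy
    · exact fun hx => ⟨⟨x, fun h => h0 (h ▸ hx)⟩, hx, rfl⟩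
  refine (comap_subtype_coe_apply (isOpen_ne_zero (d := d)).measurableSet _ _).trans ?_
  refine (congrArg _ h1).trans ?_
  rw [Measure.map_apply (measurable_scaled hX t) hB]
  rfl

instance [IsFiniteMeasure P] (t : ℝ) : IsFiniteMeasure (scaledLaw P X t) := by
  constructor
  refine (comap_subtype_coe_apply (isOpen_ne_zero (d := d)).measurableSet _ _).trans_lt ?_
  exact measure_lt_top _ _

/-- Puncturing discards only the mass at the origin, which g does not see. -/
theorem integral_comap_val (m : Measure (Fin d → ℝ≥0∞)) {g : (Fin d → ℝ≥0∞) → ℝ} (h0 : g 0 = 0) :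
    ∫ x : PuncturedOrthant d, g x.1 ∂(m.comap Subtype.val) = ∫ x, g x ∂m := by
  refine (integral_subtype_comap (isOpen_ne_zero (d := d)).measurableSet g).trans ?_
  rw [setIntegral_eq_integral_of_forall_compl_eq_zero]
  intro x hx
  rw [not_not.1 hx, h0]

theorem integral_scaledLaw (hX : Measurable X) (t : ℝ) {g : (Fin d → ℝ≥0∞) → ℝ}
    (hg : Measurable g) (h0 : g 0 = 0) :
    ∫ x, g x.1 ∂(scaledLaw P X t) = ∫ ω, g (fun i => ENNReal.ofReal (X ω i / t)) ∂P := by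
  rw [scaledLaw, integral_comap_val _ h0,
    integral_map (measurable_scaled hX t).aemeasurable hg.aestronglyMeasurable]

end ScaledLaw

/-! ### Changing normalizations and finding a charged coordinate -/

section Vague

variable {d : ℕ}

/-- Normalizing constants enter Bochner integrals only as real factors, so the convergence of their
ratio is all that is needed to exchange them. -/
theorem VagueTendsto.smul_of_tendsto_div {T ι : Type*} [TopologicalSpace T] [MeasurableSpace T]
    {l : Filter ι} {m : ι → Measure T} {ν : Measure T} {a b : ι → ℝ≥0∞}
    (h : VagueTendsto l (fun i => b i • m i) ν) {r : ℝ} (hr0 : 0 ≤ r)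
    (hr : Tendsto (fun i => (a i).toReal / (b i).toReal) l (𝓝 r))
    (hb : ∀ᶠ i in l, (b i).toReal ≠ 0) :
    VagueTendsto l (fun i => a i • m i) (ENNReal.ofReal r • ν) := by
  intro f hf hfs
  have := hr.mul (h f hf hfs)
  rw [integral_smul_measure, ENNReal.toReal_ofReal hr0]
  refine this.congr' ?_
  filter_upwards [hb] with i hi
  rw [integral_smul_measure, integral_smul_measure, smul_eq_mul, smul_eq_mul]
  field_simp

/-- Convergence of the masses of superlevel sets with null boundary. -/
theorem VagueTendsto.tendsto_measureReal_lt {ι : Type*} {l : Filter ι}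
    {ν : ι → Measure (PuncturedOrthant d)} {ν₀ : Measure (PuncturedOrthant d)}
    (h : VagueTendsto l ν ν₀)
    [∀ i, IsFiniteMeasureOnCompacts (ν i)] [IsFiniteMeasureOnCompacts ν₀]
    {ψ : (Fin d → ℝ≥0∞) → ℝ≥0∞} (hψ : Continuous ψ) (h0 : ψ 0 = 0) {s : ℝ≥0∞} (hs : 0 < s)
    (hnull : ν₀ {x | ψ x.1 = s} = 0) :
    Tendsto (fun i => (ν i).real {x | s < ψ x.1}) l (𝓝 (ν₀.real {x | s < ψ x.1})) := by
  have hψ' : Continuous fun x : PuncturedOrthant d => ψ x.1 := hψ.comp continuous_subtype_val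
  have hop : IsOpen {x : PuncturedOrthant d | s < ψ x.1} := isOpen_lt continuous_const hψ'
  have key := h.tendsto_integral_of_continuousAt (M := 1)
    (g := {x : PuncturedOrthant d | s < ψ x.1}.indicator 1)
    (measurable_one.indicator hop.measurableSet)
    (hasCompactSupport_of_le_entrySum hψ h0 hs fun x hx =>
      Set.indicator_of_notMem (s := {x : PuncturedOrthant d | s < ψ x.1}) (fun hx' : s < ψ x.1 => hx'.not_gt hx) _)
    (fun x => by
      by_cases hx : x ∈ {x : PuncturedOrthant d | s < ψ x.1} <;> simp [hx])
    (isClosed_eq hψ' continuous_const) hnull fun x hx => ?_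
  · simpa only [integral_indicator_one hop.measurableSet] using key
  · rcases lt_or_gt_of_ne hx with hlt | hgt
    · refine (continuousAt_const (y := (0 : ℝ))).congr ?_
      filter_upwards [(isOpen_lt hψ' continuous_const).mem_nhds hlt] with y hy
      exact (Set.indicator_of_notMem (s := {x : PuncturedOrthant d | s < ψ x.1}) (fun hy' : s < ψ y.1 => hy'.not_gt hy) _).symm
    · refine (continuousAt_const (y := (1 : ℝ))).congr ?_
      filter_upwards [hop.mem_nhds hgt] with y hy
      exact (Set.indicator_of_mem (s := {x : PuncturedOrthant d | s < ψ x.1}) hy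
        (1 : PuncturedOrthant d → ℝ)).symm

theorem measure_le_lt_top (ν : Measure (PuncturedOrthant d)) [IsFiniteMeasureOnCompacts ν]
    {ψ : (Fin d → ℝ≥0∞) → ℝ≥0∞} (hψ : Continuous ψ) (h0 : ψ 0 = 0) {s : ℝ≥0∞} (hs : 0 < s) :
    ν {x | s ≤ ψ x.1} < ∞ :=
  (isCompact_le_of_continuous hψ h0 hs).measure_lt_top

theorem measure_gt_lt_top (ν : Measure (PuncturedOrthant d)) [IsFiniteMeasureOnCompacts ν]
    {ψ : (Fin d → ℝ≥0∞) → ℝ≥0∞} (hψ : Continuous ψ) (h0 : ψ 0 = 0) {s : ℝ≥0∞} (hs : 0 < s) :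
    ν {x | s < ψ x.1} < ∞ :=
  (measure_mono fun _ (h : s < _) => h.le).trans_lt (measure_le_lt_top ν hψ h0 hs)

/-- The sets {x_j > 1/(n+1)} form a countable cover of the punctured orthant, so a nonzero measure
charges one of them. The level is then adjusted to make the boundary null. -/
theorem exists_coord_measure_pos (μ : Measure (PuncturedOrthant d)) [IsFiniteMeasureOnCompacts μ]
    (hμ : μ ≠ 0) : ∃ (j : Fin d) (s : ℝ), 0 < s ∧ 0 < μ {x | ENNReal.ofReal s < x.1 j} ∧
      μ {x | x.1 j = ENNReal.ofReal s} = 0 := by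
  obtain ⟨j, n, hjn⟩ : ∃ (j : Fin d) (n : ℕ),
      0 < μ {x | ENNReal.ofReal (1 / ((n : ℝ) + 1)) < x.1 j} := by
    by_contra! hc
    refine hμ (Measure.measure_univ_eq_zero.1 ?_)
    have : (Set.univ : Set (PuncturedOrthant d)) ⊆ ⋃ (j : Fin d), ⋃ (n : ℕ),
        {x | ENNReal.ofReal (1 / ((n : ℝ) + 1)) < x.1 j} := by
      intro x _
      obtain ⟨j, hj⟩ := Function.ne_iff.1 x.2
      obtain ⟨δ, hδ0, hδ⟩ := ENNReal.lt_iff_exists_real_btwn.1 (pos_iff_ne_zero.2 hj)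
      obtain ⟨n, hn⟩ := exists_nat_one_div_lt (ENNReal.ofReal_pos.1 hδ.1)
      exact Set.mem_iUnion₂.2 ⟨j, n, (ENNReal.ofReal_le_ofReal hn.le).trans_lt hδ.2⟩
    refine measure_mono_null this (measure_iUnion_null fun j => measure_iUnion_null fun n => ?_)
    exact nonpos_iff_eq_zero.1 (hc j n)
  have hr : 0 < 1 / ((n : ℝ) + 1) := by positivity
  set r := 1 / ((n : ℝ) + 1)
  have hm : Measurable fun x : PuncturedOrthant d => x.1 j :=
    (measurable_pi_apply j).comp measurable_subtype_coe
  have hcount := (Measure.countable_meas_level_set_pos (μ := μ) hm)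
  -- Only countably many levels carry mass, whereas (0, r) is uncountable. Lowering the level from r
  -- to s enlarges the superlevel set.
  obtain ⟨s, hs, hs0⟩ : ∃ s ∈ Set.Ioo 0 r, μ {x | x.1 j = ENNReal.ofReal s} = 0 := by
    by_contra! hc
    have hsub : (ENNReal.ofReal '' Set.Ioo 0 r) ⊆ {t | 0 < μ {x | x.1 j = t}} := by
      rintro _ ⟨s, hs, rfl⟩
      exact pos_iff_ne_zero.2 (hc s hs)
    have hinj : Set.InjOn ENNReal.ofReal (Set.Ioo 0 r) := fun a ha b hb hab =>
      (ENNReal.ofReal_eq_ofReal_iff ha.1.le hb.1.le).1 hab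
    have := (Set.countable_of_injective_of_countable_image hinj (hcount.mono hsub)).measure_zero
      volume
    rw [Real.volume_Ioo, sub_zero] at this
    exact (ENNReal.ofReal_pos.2 hr).ne' this
  refine ⟨j, s, hs.1, hjn.trans_le (measure_mono fun x hx => ?_), hs0⟩
  exact (ENNReal.ofReal_le_ofReal hs.2.le).trans_lt hx

end Vague

/-! ### Homogeneity of limits under power normalization -/

section Homogeneous

variable {d : ℕ}

/-- The law of `X / t` on the punctured orthant, multiplied by `t ^ α`. -/
noncomputable def rescaledLaw {Ω : Type*} [MeasurableSpace Ω] (P : Measure Ω)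
    (X : Ω → Fin d → ℝ) (α t : ℝ) : Measure (PuncturedOrthant d) :=
  ENNReal.ofReal (t ^ α) • scaledLaw P X t

instance {Ω : Type*} [MeasurableSpace Ω] {P : Measure Ω} [IsFiniteMeasure P]
    {X : Ω → Fin d → ℝ} {α t : ℝ} : IsFiniteMeasure (rescaledLaw P X α t) :=
  Measure.smul_finite _ ENNReal.ofReal_ne_top

theorem integral_rescaledLaw {Ω : Type*} [MeasurableSpace Ω] {P : Measure Ω}
    {X : Ω → Fin d → ℝ} (hX : Measurable X) {α t : ℝ} (ht : 0 < t)
    {g : (Fin d → ℝ≥0∞) → ℝ} (hg : Measurable g) (h0 : g 0 = 0) :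
    ∫ x, g x.1 ∂(rescaledLaw P X α t) =
      t ^ α * ∫ ω, g (fun i => ENNReal.ofReal (X ω i / t)) ∂P := by
  rw [rescaledLaw, integral_smul_measure, integral_scaledLaw hX t hg h0,
    ENNReal.toReal_ofReal (Real.rpow_nonneg ht.le α), smul_eq_mul]

theorem measureReal_rescaledLaw_gt {Ω : Type*} [MeasurableSpace Ω] {P : Measure Ω}
    {X : Ω → Fin d → ℝ} (hX : Measurable X) {α t : ℝ} (ht : 0 < t)
    {ψ : (Fin d → ℝ≥0∞) → ℝ≥0∞} (hψ : Continuous ψ) (h0 : ψ 0 = 0) (s : ℝ≥0∞) :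
    (rescaledLaw P X α t).real {x | s < ψ x.1} =
      t ^ α * P.real {ω | s < ψ (fun i => ENNReal.ofReal (X ω i / t))} := by
  rw [rescaledLaw, measureReal_ennreal_smul_apply,
    ENNReal.toReal_ofReal (Real.rpow_nonneg ht.le α), measureReal_def, measureReal_def]
  congr 2
  exact scaledLaw_preimage hX t (B := {y | s < ψ y}) (isOpen_lt continuous_const hψ).measurableSet
    (by simp [h0])

/-- The vague limit of the measures `t ^ α P (X ∈ t ·)` is homogeneous. -/
theorem isHomogeneous_of_vagueTendsto {Ω : Type*} [MeasurableSpace Ω] {P : Measure Ω}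
    {X : Ω → Fin d → ℝ} (hX : Measurable X) {α : ℝ} {ν : Measure (PuncturedOrthant d)}
    [IsFiniteMeasureOnCompacts ν] (h : VagueTendsto atTop (rescaledLaw P X α) ν) :
    IsHomogeneous ν α := by
  have key : ∀ u : ℝ, ∀ hu : 0 < u,
      ν.map (dilateHomeomorph d u hu) = ENNReal.ofReal (u ^ α) • ν := by
    intro u hu
    have hua : 0 < u ^ α := Real.rpow_pos_of_pos hu α
    have hfc : IsFiniteMeasureOnCompacts (ν.map (dilateHomeomorph d u hu)) := by
      constructor
      intro K hK
      rw [(dilateHomeomorph d u hu).measurableEmbedding.map_apply]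
      exact ((dilateHomeomorph d u hu).isCompact_preimage.2 hK).measure_lt_top
    have hfc' : IsFiniteMeasureOnCompacts (ENNReal.ofReal (u ^ α) • ν) :=
      IsFiniteMeasureOnCompacts.smul ν ENNReal.ofReal_ne_top
    refine Measure.ext_of_integral_eq_on_compactlySupported fun f => ?_
    rw [(dilateHomeomorph d u hu).measurableEmbedding.integral_map, integral_smul_measure,
      ENNReal.toReal_ofReal hua.le, smul_eq_mul]
    obtain ⟨g, hgc, hgf, -, δ, hδ0, hδ⟩ :=
      exists_extension_of_hasCompactSupport f.continuous f.hasCompactSupport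
    have hg0 : g 0 = 0 := hδ 0 (by rw [entrySum_eq_zero.2 rfl]; simpa using hδ0)
    set D : (Fin d → ℝ≥0∞) → (Fin d → ℝ≥0∞) := fun x i => ENNReal.ofReal u * x i with hD
    have hDc : Continuous D := continuous_pi fun i =>
      (ENNReal.continuous_const_mul ENNReal.ofReal_ne_top).comp (continuous_apply i)
    -- One quantity seen in two ways: t^α E f(uX/t) equals u^α (t/u)^α E f(X/(t/u)). The limits of
    -- the two sides are the integrals to be compared.
    have h1 := h _ (f.continuous.comp (dilateHomeomorph d u hu).continuous)
      (f.hasCompactSupport.comp_homeomorph (dilateHomeomorph d u hu))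
    have h2 := ((h f f.continuous f.hasCompactSupport).comp
      (tendsto_id.atTop_div_const hu)).const_mul (u ^ α)
    refine tendsto_nhds_unique (h1.congr' ?_) h2
    filter_upwards [eventually_gt_atTop 0] with t ht
    have e1 : ∀ x : PuncturedOrthant d, (f ∘ dilateHomeomorph d u hu) x = (g ∘ D) x.1 :=
      fun x => (hgf _).symm
    have e2 : ∀ x : PuncturedOrthant d, f x = g x.1 := fun x => (hgf x).symm
    have hD0 : D 0 = 0 := by ext; simp [hD]
    refine (integral_congr_ae (ae_of_all _ e1)).trans (Eq.trans ?_ (congrArg (u ^ α * ·)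
      (integral_congr_ae (μ := rescaledLaw P X α (t / u)) (ae_of_all _ e2)).symm))
    rw [integral_rescaledLaw hX ht (hgc.comp hDc).measurable (by simp [hD0, hg0]),
      integral_rescaledLaw hX (div_pos ht hu) hgc.measurable hg0, ← mul_assoc,
      Real.div_rpow ht.le hu.le, mul_div_cancel₀ _ hua.ne']
    congr 2
    ext ω
    simp only [Function.comp_apply, hD]
    congr 1
    ext i
    rw [← ENNReal.ofReal_mul hu.le]
    congr 1
    field_simp
  intro u hu S hS
  have hpos : 0 < u ^ α := Real.rpow_pos_of_pos hu α
  have h1 := congrArg (fun m : Measure (PuncturedOrthant d) => m (dilate u S)) (key u hu)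
  simp only [Measure.smul_apply, smul_eq_mul] at h1
  rw [dilate_eq_image hu, (dilateHomeomorph d u hu).measurableEmbedding.map_apply,
    Set.preimage_image_eq _ (dilateHomeomorph d u hu).injective, ← dilate_eq_image hu] at h1
  rw [h1, ← mul_assoc, ← ENNReal.ofReal_mul (Real.rpow_nonneg hu.le _), ← Real.rpow_add hu,
    neg_add_cancel, Real.rpow_zero, ENNReal.ofReal_one, one_mul]

/-- Superlevel sets of positively homogeneous functions are dilated into each other. -/
theorem dilate_gt {ψ : (Fin d → ℝ≥0∞) → ℝ≥0∞}
    (hom : ∀ u : ℝ, 0 < u → ∀ x, ψ (fun i => ENNReal.ofReal u * x i) = ENNReal.ofReal u * ψ x)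
    {s : ℝ} (hs : 0 < s) :
    dilate s {x : PuncturedOrthant d | 1 < ψ x.1} = {x | ENNReal.ofReal s < ψ x.1} := by
  have hs0 : ENNReal.ofReal s ≠ 0 := by simpa using hs
  have aux : ∀ y, ENNReal.ofReal s < ENNReal.ofReal s * y ↔ 1 < y := fun y => by
    conv_lhs => lhs; rw [← mul_one (ENNReal.ofReal s)]
    exact ENNReal.mul_lt_mul_iff_right hs0 ENNReal.ofReal_ne_top
  rw [dilate_eq_image hs]
  ext x
  constructor
  · rintro ⟨y, hy, rfl⟩
    rw [Set.mem_ofPred_eq, dilateHomeomorph_apply, hom s hs, aux]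
    exact hy
  · intro hx
    obtain ⟨y, rfl⟩ := (dilateHomeomorph d s hs).surjective x
    rw [Set.mem_ofPred_eq, dilateHomeomorph_apply, hom s hs, aux] at hx
    exact ⟨y, hx, rfl⟩

theorem IsHomogeneous.measure_gt {ν : Measure (PuncturedOrthant d)} {α : ℝ}
    (h : IsHomogeneous ν α) {ψ : (Fin d → ℝ≥0∞) → ℝ≥0∞} (hψ : Continuous ψ)
    (hom : ∀ u : ℝ, 0 < u → ∀ x, ψ (fun i => ENNReal.ofReal u * x i) = ENNReal.ofReal u * ψ x)
    {s : ℝ} (hs : 0 < s) :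
    ν {x | ENNReal.ofReal s < ψ x.1} = ENNReal.ofReal (s ^ (-α)) * ν {x | 1 < ψ x.1} := by
  rw [← dilate_gt hom hs]
  exact h s hs _ (isOpen_lt continuous_const (hψ.comp continuous_subtype_val)).measurableSet

/-- Level sets of positively homogeneous functions are null for homogeneous measures. -/
theorem IsHomogeneous.measure_eq_zero {ν : Measure (PuncturedOrthant d)}
    [IsFiniteMeasureOnCompacts ν] {α : ℝ}
    (h : IsHomogeneous ν α) {ψ : (Fin d → ℝ≥0∞) → ℝ≥0∞} (hψ : Continuous ψ)
    (hom : ∀ u : ℝ, 0 < u → ∀ x, ψ (fun i => ENNReal.ofReal u * x i) = ENNReal.ofReal u * ψ x)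
    {s : ℝ} (hs : 0 < s) : ν {x | ψ x.1 = ENNReal.ofReal s} = 0 := by
  have hψ' : Continuous fun x : PuncturedOrthant d => ψ x.1 := hψ.comp continuous_subtype_val
  by_contra hne
  -- If one level carried mass, dilation would give mass to every positive level, that is, to
  -- uncountably many disjoint sets.
  have hsub : ENNReal.ofReal '' Set.Ioi 0 ⊆ {t | 0 < ν {x | ψ x.1 = t}} := by
    rintro _ ⟨r, hr, rfl⟩
    have hrs : 0 < r / s := div_pos hr hs
    have h1 := h (r / s) hrs {x | ψ x.1 = ENNReal.ofReal s}
      (isClosed_eq hψ' continuous_const).measurableSet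
    have h2 : 0 < ν (dilate (r / s) {x : PuncturedOrthant d | ψ x.1 = ENNReal.ofReal s}) := by
      rw [h1]
      exact ENNReal.mul_pos (ENNReal.ofReal_pos.2 (Real.rpow_pos_of_pos hrs _)).ne' hne
    refine h2.trans_le (measure_mono ?_)
    rw [dilate_eq_image hrs]
    rintro _ ⟨y, hy, rfl⟩
    rw [Set.mem_ofPred_eq] at hy
    rw [Set.mem_ofPred_eq, dilateHomeomorph_apply, hom _ hrs, hy, ← ENNReal.ofReal_mul hrs.le,
      div_mul_cancel₀ _ hs.ne']
  have hinj : Set.InjOn ENNReal.ofReal (Set.Ioi 0) := fun a ha b hb hab =>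
    (ENNReal.ofReal_eq_ofReal_iff (le_of_lt ha) (le_of_lt hb)).1 hab
  have := (Set.countable_of_injective_of_countable_image hinj
    ((Measure.countable_meas_level_set_pos (μ := ν) hψ'.measurable).mono hsub)).measure_zero volume
  rw [Real.volume_Ioi] at this
  exact ENNReal.top_ne_zero this

end Homogeneous

/-! ### From the given normalization to a power of t -/

section Pareto

variable {Ω : Type*} [MeasurableSpace Ω] {P : Measure Ω} [IsProbabilityMeasure P] {d : ℕ}

/-- If one component with positive limiting mass has a Pareto tail, then the normalization of
vague convergence can be chosen to be a power function. -/
theorem exists_vagueTendsto_rescaledLaw {V : Ω → Fin d → ℝ} (hV : Measurable V)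
    {α : ℝ} {K : Fin d → ℝ} (hK : ∀ j, 0 < K j)
    (hPareto : ∀ j, Tendsto (fun t : ℝ => P.real {ω | t < V ω j} / (K j * t ^ (-α)))
      atTop (𝓝 1))
    {μ : Measure (PuncturedOrthant d)} [IsFiniteMeasureOnCompacts μ] (hμ0 : μ ≠ 0)
    {D : Set (PuncturedOrthant d)}
    (h : VagueTendsto atTop (fun t : ℝ => (scaledLaw P V t D)⁻¹ • scaledLaw P V t) μ) :
    ∃ c : ℝ, 0 < c ∧ VagueTendsto atTop (rescaledLaw P V α) (ENNReal.ofReal c • μ) := by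
  obtain ⟨j, s, hs, hpos, hnull⟩ := exists_coord_measure_pos μ hμ0
  have hs' : 0 < ENNReal.ofReal s := ENNReal.ofReal_pos.2 hs
  -- The inverse is ∞ when D has scaled mass 0. Replacing ∞ by 0 leaves all Bochner integrals
  -- unchanged and makes the normalized measures finite.
  set b : ℝ → ℝ≥0∞ := fun t => ENNReal.ofReal ((scaledLaw P V t D)⁻¹).toReal with hb
  have hbt : ∀ t, (b t).toReal = ((scaledLaw P V t D)⁻¹).toReal := fun t =>
    ENNReal.toReal_ofReal ENNReal.toReal_nonneg
  have hbv : VagueTendsto atTop (fun t : ℝ => b t • scaledLaw P V t) μ := by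
    intro f hf hfs
    simpa only [integral_smul_measure, hbt] using h f hf hfs
  have : ∀ t, IsFiniteMeasure (b t • scaledLaw P V t) := fun t =>
    Measure.smul_finite _ ENNReal.ofReal_ne_top
  have hcj : Continuous fun x : Fin d → ℝ≥0∞ => x j := continuous_apply j
  have h1 := hbv.tendsto_measureReal_lt hcj rfl hs' hnull
  set p := μ.real {x | ENNReal.ofReal s < x.1 j} with hp
  have hp0 : 0 < p := ENNReal.toReal_pos hpos.ne'
    (measure_gt_lt_top μ hcj rfl hs').ne
  have e1 : ∀ t, 0 < t → (b t • scaledLaw P V t).real {x | ENNReal.ofReal s < x.1 j} =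
      (b t).toReal * P.real {ω | s * t < V ω j} := by
    intro t ht
    rw [measureReal_ennreal_smul_apply, measureReal_def, measureReal_def]
    congr 2
    refine (scaledLaw_preimage hV t (B := {y | ENNReal.ofReal s < y j})
      (isOpen_lt continuous_const hcj).measurableSet (by simp)).trans ?_
    congr 1
    ext ω
    rw [Set.mem_ofPred_eq, Set.mem_ofPred_eq, Set.mem_ofPred_eq, ENNReal.ofReal_lt_ofReal_iff', lt_div_iff₀ ht]
    exact ⟨fun h => h.1, fun h => ⟨h, div_pos ((mul_pos hs ht).trans h) ht⟩⟩
  have h1' : Tendsto (fun t => (b t).toReal * P.real {ω | s * t < V ω j}) atTop (𝓝 p) :=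
    h1.congr' (by filter_upwards [eventually_gt_atTop 0] with t ht using e1 t ht)
  -- Both normalizations are tested on the same event {V_j > st}; dividing the two limits gives c =
  -- K_j s^(-α) / p.
  have h2 : Tendsto (fun t => t ^ α * P.real {ω | s * t < V ω j}) atTop
      (𝓝 (K j * s ^ (-α))) := by
    have := ((hPareto j).comp (tendsto_id.const_mul_atTop hs)).const_mul (K j * s ^ (-α))
    rw [mul_one] at this
    refine this.congr' ?_
    filter_upwards [eventually_gt_atTop 0] with t ht
    simp only [Function.comp_apply, id]
    have hk := (hK j).ne'
    have hsα := (Real.rpow_pos_of_pos hs (-α)).ne'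
    have htα := (Real.rpow_pos_of_pos ht α).ne'
    rw [Real.mul_rpow hs.le ht.le, Real.rpow_neg ht.le]
    field_simp
  have hc : 0 < K j * s ^ (-α) / p := div_pos (mul_pos (hK j) (Real.rpow_pos_of_pos hs _)) hp0
  have hbP := h1'.eventually_const_lt hp0
  refine ⟨_, hc, hbv.smul_of_tendsto_div hc.le ((h2.div h1' hp0.ne').congr' ?_) ?_⟩
  · filter_upwards [hbP, eventually_gt_atTop 0] with t ht ht0
    rw [ENNReal.toReal_ofReal (Real.rpow_nonneg ht0.le _), Pi.div_apply,
      mul_div_mul_right _ _ (right_ne_zero_of_mul ht.ne')]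
  · filter_upwards [hbP] with t ht using left_ne_zero_of_mul ht.ne'

end Pareto

/-! ### The mean image measure: finiteness on compacts and positivity -/

section MeanMeasure

variable {Ω : Type*} [MeasurableSpace Ω] {P : Measure Ω} {q d : ℕ}
  {A : Ω → Fin q → Fin d → ℝ} {ν : Measure (PuncturedOrthant d)}

theorem measurable_extMulVec_comp {β : Type*} [MeasurableSpace β] {a : β → Fin q → Fin d → ℝ}
    (ha : Measurable a) {x : β → Fin d → ℝ≥0∞} (hx : Measurable x) :
    Measurable fun b => extMulVec (a b) (x b) :=
  measurable_pi_lambda _ fun i => Finset.measurable_fun_sum _ fun j _ =>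
    (((measurable_pi_apply j).comp ((measurable_pi_apply i).comp ha)).ennreal_ofReal).mul
      ((measurable_pi_apply j).comp hx)

/-- The measure `E ν ∘ A⁻¹` on the punctured orthant. -/
noncomputable def meanMeasure (P : Measure Ω) (A : Ω → Fin q → Fin d → ℝ)
    (ν : Measure (PuncturedOrthant d)) : Measure (PuncturedOrthant q) :=
  ((P.prod ν).map fun p => extMulVec (A p.1) p.2.1).comap Subtype.val

theorem measurable_extMulVec_prod (hA : Measurable A) :
    Measurable fun p : Ω × PuncturedOrthant d => extMulVec (A p.1) p.2.1 :=
  measurable_extMulVec_comp (hA.comp measurable_fst) (measurable_subtype_coe.comp measurable_snd)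

theorem measurableSet_extMulVec_mem (hA : Measurable A) {S : Set (Fin q → ℝ≥0∞)}
    (hS : MeasurableSet S) :
    MeasurableSet {p : Ω × PuncturedOrthant d | extMulVec (A p.1) p.2.1 ∈ S} :=
  measurable_extMulVec_prod hA hS

theorem measurableSet_image_val {B : Set (PuncturedOrthant q)} (hB : MeasurableSet B) :
    MeasurableSet (Subtype.val '' B) :=
  (MeasurableEmbedding.subtype_coe (isOpen_ne_zero (d := q)).measurableSet).measurableSet_image' hB

theorem meanMeasure_apply_prod (hA : Measurable A) {B : Set (PuncturedOrthant q)}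
    (hB : MeasurableSet B) : meanMeasure P A ν B =
      (P.prod ν) {p | extMulVec (A p.1) p.2.1 ∈ Subtype.val '' B} := by
  refine (comap_subtype_coe_apply (isOpen_ne_zero (d := q)).measurableSet _ _).trans ?_
  exact Measure.map_apply (measurable_extMulVec_prod hA) (measurableSet_image_val hB)

theorem meanMeasure_apply [SFinite ν] (hA : Measurable A) {B : Set (PuncturedOrthant q)}
    (hB : MeasurableSet B) : meanMeasure P A ν B = meanImage P A ν B := by
  rw [meanMeasure_apply_prod hA hB, Measure.prod_apply
    (measurableSet_extMulVec_mem hA (measurableSet_image_val hB))]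
  rfl

/-- Otherwise the qd products would sum to at most qd·δ/(qd + 1) < δ. The added 1 provides
strictness and also covers qd = 0. -/
theorem exists_lt_mul_of_le_entrySum {δ : ℝ} (hδ : 0 < δ) {a : Fin q → Fin d → ℝ}
    {x : Fin d → ℝ≥0∞} (h : ENNReal.ofReal δ ≤ entrySum (extMulVec a x)) :
    ∃ i j, ENNReal.ofReal (δ / (q * d + 1)) < ENNReal.ofReal (a i j) * x j := by
  by_contra! hc
  refine h.not_gt ?_
  have h1 : entrySum (extMulVec a x) ≤ ∑ _i : Fin q, ∑ _j : Fin d,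
      ENNReal.ofReal (δ / (q * d + 1)) :=
    Finset.sum_le_sum fun i _ => Finset.sum_le_sum fun j _ => hc i j
  refine h1.trans_lt ?_
  have hpos : (0 : ℝ) < q * d + 1 := by positivity
  simp only [Finset.sum_const, Finset.card_univ, Fintype.card_fin, nsmul_eq_mul]
  rw [← ENNReal.ofReal_natCast, ← ENNReal.ofReal_natCast, ← ENNReal.ofReal_mul (by positivity),
    ← ENNReal.ofReal_mul (by positivity), ENNReal.ofReal_lt_ofReal_iff hδ]
  rw [← mul_assoc, ← mul_div_assoc, div_lt_iff₀ hpos]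
  nlinarith

theorem IsHomogeneous.measure_coord_gt {α : ℝ} (hα : 0 < α) (hν : IsHomogeneous ν α) {η : ℝ}
    (hη : 0 < η) {a : ℝ} (ha : 0 ≤ a) (j : Fin d) :
    ν {x | ENNReal.ofReal η < ENNReal.ofReal a * x.1 j} =
      ENNReal.ofReal (a ^ α) * (ENNReal.ofReal (η ^ (-α)) * ν {x | 1 < x.1 j}) := by
  rcases ha.eq_or_lt with rfl | ha
  · simp [Real.zero_rpow hα.ne']
  have h1 : {x : PuncturedOrthant d | ENNReal.ofReal η < ENNReal.ofReal a * x.1 j} =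
      {x | ENNReal.ofReal (η / a) < x.1 j} := by
    ext x
    rw [Set.mem_ofPred_eq, Set.mem_ofPred_eq, ENNReal.ofReal_div_of_pos ha, mul_comm,
      ENNReal.div_lt_iff (.inl (ENNReal.ofReal_pos.2 ha).ne') (.inl ENNReal.ofReal_ne_top)]
  rw [h1, hν.measure_gt (ψ := fun x => x j) (continuous_apply j) (fun _ _ _ => rfl)
    (div_pos hη ha), ← mul_assoc, ← ENNReal.ofReal_mul (Real.rpow_nonneg ha.le _)]
  congr 2
  rw [Real.div_rpow hη.le ha.le, Real.rpow_neg ha.le, div_inv_eq_mul, mul_comm]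

/-- A union bound over the pairs (i, j) and homogeneity bound the ν-mass for fixed ω by a linear
combination of the A_ij^α. The moment condition then makes its expectation finite. -/
theorem meanMeasure_entrySum_lt_top [IsFiniteMeasureOnCompacts ν] {α : ℝ} (hα : 0 < α)
    (hν : IsHomogeneous ν α) (hA : Measurable A) (hA0 : ∀ ω i j, 0 ≤ A ω i j)
    (hAmom : ∀ i j, Integrable (fun ω => A ω i j ^ α) P) {δ : ℝ} (hδ : 0 < δ) :
    (P.prod ν) {p | ENNReal.ofReal δ ≤ entrySum (extMulVec (A p.1) p.2.1)} < ∞ := by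
  have hη : 0 < δ / (q * d + 1) := by positivity
  set η := δ / (q * d + 1)
  refine (Measure.prod_apply (measurableSet_extMulVec_mem hA
    (S := {y | ENNReal.ofReal δ ≤ entrySum y})
    (isClosed_le continuous_const continuous_entrySum).measurableSet)).trans_lt ?_
  calc _ ≤ ∫⁻ ω, ∑ i, ∑ j, ENNReal.ofReal (A ω i j ^ α) *
        (ENNReal.ofReal (η ^ (-α)) * ν {x | 1 < x.1 j}) ∂P := by
        refine lintegral_mono fun ω => ?_
        have hsub : {x : PuncturedOrthant d |
            ENNReal.ofReal δ ≤ entrySum (extMulVec (A ω) x.1)} ⊆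
            ⋃ i ∈ (Finset.univ : Finset (Fin q)), ⋃ j ∈ (Finset.univ : Finset (Fin d)),
              {x | ENNReal.ofReal η < ENNReal.ofReal (A ω i j) * x.1 j} := by
          intro x hx
          obtain ⟨i, j, hij⟩ := exists_lt_mul_of_le_entrySum hδ hx
          simp only [Set.mem_iUnion]
          exact ⟨i, Finset.mem_univ i, j, Finset.mem_univ j, hij⟩
        refine (measure_mono hsub).trans ((measure_biUnion_finset_le _ _).trans
          (Finset.sum_le_sum fun i _ => (measure_biUnion_finset_le _ _).trans
            (Finset.sum_le_sum fun j _ => ?_)))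
        exact (hν.measure_coord_gt hα hη (hA0 ω i j) j).le
    _ = ∑ i, ∑ j, ∫⁻ ω, ENNReal.ofReal (A ω i j ^ α) *
        (ENNReal.ofReal (η ^ (-α)) * ν {x | 1 < x.1 j}) ∂P := by
        have hm : ∀ i j, Measurable fun ω => ENNReal.ofReal (A ω i j ^ α) *
            (ENNReal.ofReal (η ^ (-α)) * ν {x | 1 < x.1 j}) := fun i j =>
          ((((measurable_pi_apply j).comp ((measurable_pi_apply i).comp hA)).pow_const
            α).ennreal_ofReal).mul_const _
        rw [lintegral_finsetSum _ fun i _ => Finset.measurable_fun_sum _ fun j _ => hm i j]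
        exact Finset.sum_congr rfl fun i _ => lintegral_finsetSum _ fun j _ => hm i j
    _ < ∞ := by
        refine ENNReal.sum_lt_top.2 fun i _ => ENNReal.sum_lt_top.2 fun j _ => ?_
        rw [lintegral_mul_const'']
        · exact ENNReal.mul_lt_top (hAmom i j).lintegral_lt_top
            (ENNReal.mul_lt_top ENNReal.ofReal_lt_top
              (measure_gt_lt_top ν (ψ := fun x => x j) (continuous_apply j) rfl one_pos))
        · exact (hAmom i j).aestronglyMeasurable.aemeasurable.ennreal_ofReal

theorem isFiniteMeasureOnCompacts_meanMeasure [IsFiniteMeasureOnCompacts ν] {α : ℝ} (hα : 0 < α)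
    (hν : IsHomogeneous ν α) (hA : Measurable A) (hA0 : ∀ ω i j, 0 ≤ A ω i j)
    (hAmom : ∀ i j, Integrable (fun ω => A ω i j ^ α) P) :
    IsFiniteMeasureOnCompacts (meanMeasure P A ν) := by
  constructor
  intro S hS
  obtain ⟨δ, hδ0, hδ⟩ := exists_le_entrySum_of_isCompact hS
  rw [meanMeasure_apply_prod hA hS.measurableSet]
  refine (measure_mono ?_).trans_lt (meanMeasure_entrySum_lt_top hα hν hA hA0 hAmom hδ0)
  rintro p ⟨y, hy, hyp⟩
  rw [Set.mem_ofPred_eq, ← hyp]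
  exact hδ y hy

/-- One nonzero entry of A is enough: by homogeneity the half-space in the matching coordinate has
positive mass at every level, and A sends a high enough one into the cone. -/
theorem meanMeasure_outerCone_ne_zero [IsFiniteMeasureOnCompacts ν] {α : ℝ}
    (hν : IsHomogeneous ν α) (hpos : ∀ j, ν {x | 1 < x.1 j} ≠ 0) (hA : Measurable A)
    (hA0 : ∀ ω i j, 0 ≤ A ω i j) (hAne : P {ω | A ω ≠ 0} ≠ 0)
    {N : Seminorm ℝ (Fin q → ℝ)} (hN : ∀ x, N x = 0 → x = 0) :
    meanMeasure P A ν (outerCone N) ≠ 0 := by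
  intro h
  rw [meanMeasure_apply_prod hA (isOpen_outerCone hN).measurableSet,
    Measure.measure_prod_null (measurableSet_extMulVec_mem hA
      (measurableSet_image_val (isOpen_outerCone hN).measurableSet))] at h
  refine hAne (measure_mono_null (fun ω hω => ?_) (ae_iff.1 h))
  obtain ⟨i, hi⟩ := Function.ne_iff.1 hω
  obtain ⟨j, hj⟩ := Function.ne_iff.1 hi
  have ha : 0 < A ω i j := (hA0 ω i j).lt_of_ne' hj
  obtain ⟨m, hm, hmN⟩ := exists_mul_le_extNorm hN
  -- Above this threshold for x_j, the norm of Ax is at least m A_ij x_j > 1.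
  have hma : 0 < (m * A ω i j)⁻¹ := by positivity
  have h1 := hν.measure_gt (ψ := fun x => x j) (continuous_apply j) (fun _ _ _ => rfl) hma
  have h2 : ν {x | ENNReal.ofReal (m * A ω i j)⁻¹ < x.1 j} ≠ 0 := by
    rw [h1]
    exact mul_ne_zero (ENNReal.ofReal_pos.2 (Real.rpow_pos_of_pos hma _)).ne' (hpos j)
  refine fun h0 => h2 (measure_mono_null (fun x hx => ?_) h0)
  have h3 : 1 < extNorm N (extMulVec (A ω) x.1) := by
    have hx' : ENNReal.ofReal (m * A ω i j)⁻¹ < x.1 j := hx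
    have hc : 0 < m * A ω i j := by positivity
    replace hx' := (ENNReal.mul_lt_mul_iff_right (ENNReal.ofReal_pos.2 hc).ne'
      ENNReal.ofReal_ne_top).2 hx'
    rw [← ENNReal.ofReal_mul hc.le, mul_inv_cancel₀ hc.ne', ENNReal.ofReal_one,
      ENNReal.ofReal_mul hm.le, mul_assoc] at hx'
    refine hx'.trans_le (le_trans ?_ (hmN _ i))
    gcongr
    exact Finset.single_le_sum (f := fun j => ENNReal.ofReal (A ω i j) * x.1 j)
      (fun _ _ => zero_le) (Finset.mem_univ j)
  exact ⟨⟨_, fun h => by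
    rw [show extMulVec (A ω) x.1 = 0 from h, extNorm_zero] at h3
    exact not_lt_zero h3⟩, h3, rfl⟩

end MeanMeasure

/-! ### Breiman's lemma: tail bounds and dominated convergence -/

section Breiman

variable {Ω : Type*} [MeasurableSpace Ω] {P : Measure Ω} {q d : ℕ}

theorem exists_tail_bound [IsProbabilityMeasure P] {V : Ω → ℝ} {α K : ℝ} (hα : 0 < α) (hK : 0 < K)
    (h : Tendsto (fun t : ℝ => P.real {ω | t < V ω} / (K * t ^ (-α))) atTop (𝓝 1)) :
    ∃ C : ℝ, 0 ≤ C ∧ ∀ s : ℝ, 0 < s → P.real {ω | s < V ω} ≤ C * s ^ (-α) := by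
  obtain ⟨s₀, hs₀⟩ := eventually_atTop.1 (h.eventually_lt_const one_lt_two)
  set r := max s₀ 1
  have hr : 0 < r := one_pos.trans_le (le_max_right _ _)
  have hrα := Real.rpow_pos_of_pos hr α
  -- The term 2K covers s ≥ r, where the tail ratio is below 2. For s < r the term r^α suffices, as
  -- r^α s^(-α) ≥ 1 bounds any probability.
  refine ⟨2 * K + r ^ α, by positivity, fun s hs => ?_⟩
  have hsα := Real.rpow_pos_of_pos hs (-α)
  rw [add_mul]
  rcases le_or_gt r s with hle | hlt
  · have h1 := hs₀ s ((le_max_left _ _).trans hle)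
    rw [div_lt_iff₀ (by positivity)] at h1
    nlinarith [mul_pos hrα hsα]
  · have h2 : 1 ≤ r ^ α * s ^ (-α) := by
      rw [Real.rpow_neg hs.le, ← div_eq_mul_inv, one_le_div (Real.rpow_pos_of_pos hs α)]
      exact Real.rpow_le_rpow hs.le hlt.le hα.le
    have h3 : P.real {ω | s < V ω} ≤ 1 := measureReal_le_one
    nlinarith [mul_pos hK hsα]

/-- The mass is the limit of t^α P(V_j > t), namely K_j > 0; homogeneity makes the boundary null, so
the limit may be evaluated on this set. -/
theorem measure_coord_gt_one_ne_zero [IsProbabilityMeasure P] {V : Ω → Fin d → ℝ}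
    (hV : Measurable V) {α : ℝ} {K : Fin d → ℝ} (hK : ∀ j, 0 < K j)
    (hPareto : ∀ j, Tendsto (fun t : ℝ => P.real {ω | t < V ω j} / (K j * t ^ (-α)))
      atTop (𝓝 1))
    {ν : Measure (PuncturedOrthant d)} [IsFiniteMeasureOnCompacts ν]
    (h : VagueTendsto atTop (rescaledLaw P V α) ν) (j : Fin d) : ν {x | 1 < x.1 j} ≠ 0 := by
  have hcj : Continuous fun x : Fin d → ℝ≥0∞ => x j := continuous_apply j
  have hnull := (isHomogeneous_of_vagueTendsto hV h).measure_eq_zero hcj (fun _ _ _ => rfl) one_pos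
  rw [ENNReal.ofReal_one] at hnull
  have h1 := h.tendsto_measureReal_lt hcj rfl one_pos hnull
  have h2 := (hPareto j).const_mul (K j)
  intro h0
  rw [measureReal_def, h0, ENNReal.toReal_zero] at h1
  rw [mul_one] at h2
  refine (hK j).ne (tendsto_nhds_unique (h1.congr' ?_) h2)
  filter_upwards [eventually_gt_atTop 0] with t ht
  rw [measureReal_rescaledLaw_gt hV ht hcj rfl]
  have htα := (Real.rpow_pos_of_pos ht α).ne'
  have hk := (hK j).ne'
  have hset : {ω | 1 < ENNReal.ofReal (V ω j / t)} = {ω | t < V ω j} := by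
    ext ω
    rw [Set.mem_ofPred_eq, Set.mem_ofPred_eq, ← ENNReal.ofReal_one, ENNReal.ofReal_lt_ofReal_iff',
      one_lt_div ht]
    exact ⟨fun h => h.1, fun h => ⟨h, div_pos (ht.trans h) ht⟩⟩
  rw [hset, Real.rpow_neg ht.le]
  field_simp

theorem integral_comp_of_indepFun [IsProbabilityMeasure P] {β γ : Type*} [MeasurableSpace β]
    [MeasurableSpace γ]
    {X : Ω → β} {Y : Ω → γ} (hX : Measurable X) (hY : Measurable Y) (h : IndepFun X Y P)
    {g : β × γ → ℝ} (hg : Measurable g) {M : ℝ} (hM : ∀ x, |g x| ≤ M) :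
    ∫ ω, g (X ω, Y ω) ∂P = ∫ ω, ∫ ω', g (X ω, Y ω') ∂P ∂P := by
  have h1 := (indepFun_iff_map_prod_eq_prod_map_map hX.aemeasurable hY.aemeasurable).1 h
  rw [Measure.map_prod_map _ _ hX hY] at h1
  have h2 : ∫ z, g z ∂_ = ∫ z, g z ∂_ := congrArg (fun m => ∫ z, g z ∂m) h1
  rw [integral_map (hX.prodMk hY).aemeasurable hg.aestronglyMeasurable,
    integral_map (hX.prodMap hY).aemeasurable hg.aestronglyMeasurable] at h2
  rw [h2, integral_prod]
  · rfl
  · exact Integrable.of_bound (hg.comp (hX.prodMap hY)).aestronglyMeasurable M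
      (ae_of_all _ fun z => hM _)

theorem ofReal_mulVec_div {a : Fin q → Fin d → ℝ} (ha : ∀ i j, 0 ≤ a i j) {v : Fin d → ℝ}
    (hv : ∀ j, 0 ≤ v j) {t : ℝ} (ht : 0 < t) :
    (fun i => ENNReal.ofReal ((Matrix.of a).mulVec v i / t)) =
      extMulVec a fun j => ENNReal.ofReal (v j / t) := by
  ext i
  change ENNReal.ofReal ((∑ j, a i j * v j) / t) =
    ∑ j, ENNReal.ofReal (a i j) * ENNReal.ofReal (v j / t)
  rw [Finset.sum_div,
    ENNReal.ofReal_sum_of_nonneg fun j _ => div_nonneg (mul_nonneg (ha i j) (hv j)) ht.le]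
  refine Finset.sum_congr rfl fun j _ => ?_
  rw [mul_div_assoc, ENNReal.ofReal_mul (ha i j)]

theorem measurable_mulVec {A : Ω → Fin q → Fin d → ℝ} (hA : Measurable A) {V : Ω → Fin d → ℝ}
    (hV : Measurable V) : Measurable fun ω => (Matrix.of (A ω)).mulVec (V ω) :=
  measurable_pi_lambda _ fun i =>
    Finset.measurable_fun_sum (f := fun j ω => A ω i j * V ω j) Finset.univ fun j _ =>
      ((measurable_pi_apply j).comp ((measurable_pi_apply i).comp hA)).mul
        ((measurable_pi_apply j).comp hV)

/-- Uniform bound for `t ^ α E g (a V / t)` if `g` is bounded and vanishes near zero. -/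
theorem rpow_mul_abs_integral_le [IsProbabilityMeasure P] {V : Ω → Fin d → ℝ}
    {α : ℝ} (hα : 0 < α) {C : Fin d → ℝ}
    (hC : ∀ j s, 0 < s → P.real {ω | s < V ω j} ≤ C j * s ^ (-α))
    {g : (Fin q → ℝ≥0∞) → ℝ} {M : ℝ} (hM : ∀ x, |g x| ≤ M) {δ : ℝ} (hδ : 0 < δ)
    (hgδ : ∀ x, entrySum x < ENNReal.ofReal δ → g x = 0)
    {a : Fin q → Fin d → ℝ} (ha : ∀ i j, 0 ≤ a i j) {t : ℝ} (ht : 0 < t) :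
    |t ^ α * ∫ ω, g (extMulVec a fun j => ENNReal.ofReal (V ω j / t)) ∂P| ≤
      ∑ i, ∑ j, M * (C j * (δ / (q * d + 1)) ^ (-α)) * a i j ^ α := by
  have hη : 0 < δ / (q * d + 1) := by positivity
  set η := δ / (q * d + 1) with hηdef
  have htα := Real.rpow_pos_of_pos ht α
  have hM0 : 0 ≤ M := (abs_nonneg _).trans (hM 0)
  set S := {ω | ENNReal.ofReal δ ≤ entrySum (extMulVec a fun j => ENNReal.ofReal (V ω j / t))}
  have h1 : |∫ ω, g (extMulVec a fun j => ENNReal.ofReal (V ω j / t)) ∂P| ≤ M * P.real S := by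
    rw [← setIntegral_eq_integral_of_forall_compl_eq_zero (s := S)
      fun ω hω => hgδ _ (not_le.1 hω)]
    exact norm_setIntegral_le_of_norm_le_const (f := fun ω =>
      g (extMulVec a fun j => ENNReal.ofReal (V ω j / t))) (measure_lt_top _ _) fun ω _ => hM _
  have h2 : P.real S ≤ ∑ i, ∑ j, C j * η ^ (-α) * a i j ^ α * (t ^ α)⁻¹ := by
    have hsub : S ⊆ ⋃ i ∈ (Finset.univ : Finset (Fin q)), ⋃ j ∈ (Finset.univ : Finset (Fin d)),
        {ω | η < a i j * (V ω j / t)} := by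
      intro ω hω
      obtain ⟨i, j, hij⟩ := exists_lt_mul_of_le_entrySum hδ hω
      rw [← ENNReal.ofReal_mul (ha i j), ENNReal.ofReal_lt_ofReal_iff'] at hij
      simp only [Set.mem_iUnion]
      exact ⟨i, Finset.mem_univ i, j, Finset.mem_univ j, hij.1⟩
    refine (measureReal_mono hsub (measure_ne_top _ _)).trans ((measureReal_biUnion_finset_le _ _).trans
      (Finset.sum_le_sum fun i _ => (measureReal_biUnion_finset_le _ _).trans
        (Finset.sum_le_sum fun j _ => ?_)))
    rcases (ha i j).eq_or_lt with h0 | hpos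
    -- A zero entry gives an empty event, and the bound is 0 too because α ≠ 0.
    · simp [← h0, hη.not_gt, Real.zero_rpow hα.ne']
    · have hset : {ω | η < a i j * (V ω j / t)} = {ω | η * t / a i j < V ω j} := by
        ext ω
        rw [Set.mem_ofPred_eq, Set.mem_ofPred_eq, div_lt_iff₀ hpos, ← mul_div_assoc,
          lt_div_iff₀ ht, mul_comm (a i j)]
      rw [hset]
      refine (hC j _ (by positivity)).trans (le_of_eq ?_)
      rw [Real.div_rpow (by positivity) hpos.le, Real.mul_rpow hη.le ht.le, Real.rpow_neg ht.le,
        Real.rpow_neg hpos.le]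
      field_simp
  rw [abs_mul, abs_of_pos htα]
  calc t ^ α * |∫ ω, g (extMulVec a fun j => ENNReal.ofReal (V ω j / t)) ∂P|
      ≤ t ^ α * (M * ∑ i, ∑ j, C j * η ^ (-α) * a i j ^ α * (t ^ α)⁻¹) :=
        mul_le_mul_of_nonneg_left (h1.trans (mul_le_mul_of_nonneg_left h2 hM0)) htα.le
    _ = _ := by
      simp_rw [Finset.mul_sum]
      refine Finset.sum_congr rfl fun i _ => Finset.sum_congr rfl fun j _ => ?_
      field_simp

/-- Multivariate Breiman lemma. -/
theorem vagueTendsto_rescaledLaw_mulVec [IsProbabilityMeasure P] {V : Ω → Fin d → ℝ}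
    (hV : Measurable V) (hV0 : ∀ ω j, 0 ≤ V ω j)
    {α : ℝ} (hα : 0 < α) {K : Fin d → ℝ} (hK : ∀ j, 0 < K j)
    (hPareto : ∀ j, Tendsto (fun t : ℝ => P.real {ω | t < V ω j} / (K j * t ^ (-α)))
      atTop (𝓝 1))
    {ν : Measure (PuncturedOrthant d)} [IsFiniteMeasureOnCompacts ν]
    (h : VagueTendsto atTop (rescaledLaw P V α) ν)
    {A : Ω → Fin q → Fin d → ℝ} (hA : Measurable A) (hA0 : ∀ ω i j, 0 ≤ A ω i j)
    (hAV : IndepFun A V P) (hAmom : ∀ i j, Integrable (fun ω => A ω i j ^ α) P) :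
    VagueTendsto atTop (rescaledLaw P (fun ω => (Matrix.of (A ω)).mulVec (V ω)) α)
      (meanMeasure P A ν) := by
  have hν := isHomogeneous_of_vagueTendsto hV h
  choose C hC0 hC using fun j => exists_tail_bound hα (hK j) (hPareto j)
  intro f hf hfs
  obtain ⟨g, hgc, hgf, ⟨M, hM⟩, δ, hδ0, hδ⟩ := exists_extension_of_hasCompactSupport hf hfs
  have hzero : ∀ n, entrySum (0 : Fin n → ℝ≥0∞) < ENNReal.ofReal δ := fun n => by
    rw [entrySum_eq_zero.2 rfl]; exact ENNReal.ofReal_pos.2 hδ0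
  have hg0 : g 0 = 0 := hδ 0 (hzero q)
  have hgA : ∀ a : Fin q → Fin d → ℝ, g (extMulVec a 0) = 0 := fun a => by
    rw [extMulVec_zero, hg0]
  simp_rw [← hgf]
  -- Fubini applies although ν may be infinite: the integrand is bounded by M on a set of finite
  -- product measure and vanishes elsewhere.
  have hlim : ∫ x : PuncturedOrthant q, g x.1 ∂(meanMeasure P A ν) =
      ∫ ω, ∫ x : PuncturedOrthant d, g (extMulVec (A ω) x.1) ∂ν ∂P := by
    have hm := measurable_extMulVec_prod (d := d) hA
    rw [meanMeasure, integral_comap_val _ hg0,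
      integral_map hm.aemeasurable hgc.measurable.aestronglyMeasurable, integral_prod]
    have hS := measurableSet_extMulVec_mem (d := d) hA
      (S := {y | ENNReal.ofReal δ ≤ entrySum y})
      (isClosed_le continuous_const continuous_entrySum).measurableSet
    refine Integrable.mono' (g := Set.indicator _ fun _ => M)
      (integrable_indicator_iff hS |>.2 (integrableOn_const
        (meanMeasure_entrySum_lt_top hα hν hA hA0 hAmom hδ0).ne))
      (hgc.measurable.comp hm).aestronglyMeasurable (ae_of_all _ fun p => ?_)
    by_cases hp : ENNReal.ofReal δ ≤ entrySum (extMulVec (A p.1) p.2.1)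
    · rw [Set.indicator_of_mem (by exact hp)]
      exact hM _
    · rw [Set.indicator_of_notMem (by exact hp), hδ _ (not_le.1 hp), norm_zero]
  rw [hlim]
  have heq : ∀ t : ℝ, 0 < t → ∫ x : PuncturedOrthant q, g x.1
      ∂(rescaledLaw P (fun ω => (Matrix.of (A ω)).mulVec (V ω)) α t) =
      ∫ ω, t ^ α * ∫ ω', g (extMulVec (A ω) fun j => ENNReal.ofReal (V ω' j / t)) ∂P ∂P := by
    intro t ht
    rw [integral_rescaledLaw (measurable_mulVec hA hV) ht hgc.measurable hg0, integral_const_mul]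
    congr 1
    simp_rw [ofReal_mulVec_div (hA0 _) (hV0 _) ht]
    exact integral_comp_of_indepFun hA hV hAV
      (g := fun z => g (extMulVec z.1 fun j => ENNReal.ofReal (z.2 j / t)))
      (hgc.measurable.comp (measurable_extMulVec_comp measurable_fst
        (measurable_scaled measurable_snd t))) (fun _ => hM _)
  have hmain : Tendsto (fun t : ℝ => ∫ ω, t ^ α *
      ∫ ω', g (extMulVec (A ω) fun j => ENNReal.ofReal (V ω' j / t)) ∂P ∂P) atTop
      (𝓝 (∫ ω, ∫ x : PuncturedOrthant d, g (extMulVec (A ω) x.1) ∂ν ∂P)) := by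
    refine tendsto_integral_filter_of_dominated_convergence
      (fun ω => ∑ i, ∑ j, M * (C j * (δ / (q * d + 1)) ^ (-α)) * A ω i j ^ α)
      (Eventually.of_forall fun t => ?_) ?_ ?_ (ae_of_all _ fun ω => ?_)
    · have hm : Measurable fun z : Ω × Ω =>
          g (extMulVec (A z.1) fun j => ENNReal.ofReal (V z.2 j / t)) :=
        hgc.measurable.comp (measurable_extMulVec_comp (hA.comp measurable_fst)
          ((measurable_scaled hV t).comp measurable_snd))
      exact (hm.stronglyMeasurable.integral_prod_right'.measurable.const_mul _).aestronglyMeasurable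
    · filter_upwards [eventually_gt_atTop 0] with t ht
      exact ae_of_all _ fun ω => rpow_mul_abs_integral_le hα hC hM hδ0 hδ (hA0 ω) ht
    · exact integrable_finsetSum _ fun i _ => integrable_finsetSum _ fun j _ =>
        (hAmom i j).const_mul _
    -- For a fixed matrix the composed function vanishes where the entry sum of Ax is below δ, so it
    -- is a test function even if A is singular.
    · have hc := hgc.comp (continuous_extMulVec (A ω))
      have hent : Continuous fun x : Fin d → ℝ≥0∞ => entrySum (extMulVec (A ω) x) :=
        continuous_entrySum.comp (continuous_extMulVec (A ω))
      have h1 := h _ (hc.comp continuous_subtype_val) (hasCompactSupport_of_le_entrySum hent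
        (by rw [extMulVec_zero]; exact entrySum_eq_zero.2 rfl) (ENNReal.ofReal_pos.2 hδ0)
        fun x hx => hδ _ hx)
      refine h1.congr' ?_
      filter_upwards [eventually_gt_atTop 0] with t ht
      exact integral_rescaledLaw hV ht hc.measurable (hgA _)
  exact hmain.congr' (by filter_upwards [eventually_gt_atTop 0] with t ht using (heq t ht).symm)

end Breiman

/-! ### Null sets at infinity and normalization by the norm tail -/

section Limit

variable {Ω : Type*} {q : ℕ}

theorem measurableSet_exists_eq_top :
    MeasurableSet {x : PuncturedOrthant q | ∃ i, x.1 i = ∞} := by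
  simp only [Set.ofPred_exists]
  exact MeasurableSet.iUnion fun i =>
    measurableSet_eq_fun ((measurable_pi_apply i).comp measurable_subtype_coe) measurable_const

/-- The set of points with an infinite entry has finite mass and lies inside its own dilation by 2.
Positive mass would contradict the factor 2^(-α) < 1. -/
theorem IsHomogeneous.infinity_null {ν : Measure (PuncturedOrthant q)}
    [IsFiniteMeasureOnCompacts ν] {α : ℝ} (hα : 0 < α) (h : IsHomogeneous ν α) :
    ν {x | ∃ i, x.1 i = ∞} = 0 := by
  have hdil : {x : PuncturedOrthant q | ∃ i, x.1 i = ∞} ⊆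
      dilate 2 {x : PuncturedOrthant q | ∃ i, x.1 i = ∞} := by
    rw [dilate_eq_image two_pos]
    intro x ⟨i, hi⟩
    obtain ⟨y, rfl⟩ := (dilateHomeomorph q 2 two_pos).surjective x
    refine ⟨y, ⟨i, ?_⟩, rfl⟩
    rw [dilateHomeomorph_apply] at hi
    by_contra hne
    exact ENNReal.mul_ne_top ENNReal.ofReal_ne_top hne hi
  have hfin : ν {x | ∃ i, x.1 i = ∞} < ∞ := by
    refine (measure_mono ?_).trans_lt (measure_le_lt_top ν continuous_entrySum
      (entrySum_eq_zero.2 rfl) one_pos)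
    rintro x ⟨i, hi⟩
    have h1 : x.1 i ≤ entrySum x.1 := Finset.single_le_sum (fun _ _ => zero_le) (Finset.mem_univ i)
    rw [hi, top_le_iff] at h1
    rw [Set.mem_ofPred_eq, h1]
    exact le_top
  by_contra hne
  have h1 := (measure_mono hdil).trans (h 2 two_pos _ measurableSet_exists_eq_top).le
  refine h1.not_gt ?_
  have h2 : ENNReal.ofReal ((2 : ℝ) ^ (-α)) < 1 := by
    rw [← ENNReal.ofReal_one, ENNReal.ofReal_lt_ofReal_iff one_pos]
    exact Real.rpow_lt_one_of_one_lt_of_neg one_lt_two (neg_neg_of_pos hα)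
  calc _ < 1 * ν {x | ∃ i, x.1 i = ∞} := (ENNReal.mul_lt_mul_iff_left hne hfin.ne).2 h2
    _ = _ := one_mul _

variable {N : Seminorm ℝ (Fin q → ℝ)} {X : Ω → Fin q → ℝ}

theorem extNorm_scaled (hX0 : ∀ ω i, 0 ≤ X ω i) {t : ℝ} (ht : 0 < t) (ω : Ω) :
    extNorm N (fun i => ENNReal.ofReal (X ω i / t)) = ENNReal.ofReal (N (X ω) / t) := by
  rw [extNorm_ofReal fun i => div_nonneg (hX0 ω i) ht.le]
  have : (fun i => X ω i / t) = t⁻¹ • X ω := by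
    ext i
    simp [div_eq_inv_mul]
  rw [this, map_smul_eq_mul, norm_inv, Real.norm_of_nonneg ht.le, inv_mul_eq_div]

theorem one_lt_extNorm_scaled (hX0 : ∀ ω i, 0 ≤ X ω i) {t : ℝ} (ht : 0 < t) (ω : Ω) :
    1 < extNorm N (fun i => ENNReal.ofReal (X ω i / t)) ↔ t < N (X ω) := by
  rw [extNorm_scaled hX0 ht, ← ENNReal.ofReal_one, ENNReal.ofReal_lt_ofReal_iff', one_lt_div ht]
  exact ⟨fun h => h.1, fun h => ⟨h, div_pos (ht.trans h) ht⟩⟩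

variable [MeasurableSpace Ω] {P : Measure Ω}

theorem scaledLaw_outerCone (hN : ∀ x, N x = 0 → x = 0) (hX : Measurable X)
    (hX0 : ∀ ω i, 0 ≤ X ω i) {t : ℝ} (ht : 0 < t) :
    scaledLaw P X t (outerCone N) = P {ω | t < N (X ω)} := by
  refine (scaledLaw_preimage hX t (B := {y | 1 < extNorm N y})
    (isOpen_lt continuous_const (continuous_extNorm hN)).measurableSet
    (by simp [extNorm_zero])).trans ?_
  congr 1
  ext ω
  exact one_lt_extNorm_scaled hX0 ht ω

theorem measure_outerCone_ne_top (hN : ∀ x, N x = 0 → x = 0) (ν : Measure (PuncturedOrthant q))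
    [IsFiniteMeasureOnCompacts ν] : ν (outerCone N) ≠ ∞ :=
  (measure_gt_lt_top ν (continuous_extNorm hN) extNorm_zero one_pos).ne

theorem tendsto_rpow_mul_measureReal_norm_gt [IsFiniteMeasure P] (hN : ∀ x, N x = 0 → x = 0)
    (hX : Measurable X) (hX0 : ∀ ω i, 0 ≤ X ω i) {α : ℝ} {ν : Measure (PuncturedOrthant q)}
    [IsFiniteMeasureOnCompacts ν] (h : VagueTendsto atTop (rescaledLaw P X α) ν) :
    Tendsto (fun t : ℝ => t ^ α * P.real {ω | t < N (X ω)}) atTop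
      (𝓝 (ν.real (outerCone N))) := by
  have hc := continuous_extNorm hN
  have hnull := (isHomogeneous_of_vagueTendsto hX h).measure_eq_zero hc
    (fun u hu x => extNorm_mul hu x) one_pos
  rw [ENNReal.ofReal_one] at hnull
  refine (h.tendsto_measureReal_lt hc extNorm_zero one_pos hnull).congr' ?_
  filter_upwards [eventually_gt_atTop 0] with t ht
  rw [measureReal_rescaledLaw_gt hX ht hc extNorm_zero]
  simp_rw [one_lt_extNorm_scaled hX0 ht]

theorem vagueTendsto_norm_gt [IsFiniteMeasure P] (hN : ∀ x, N x = 0 → x = 0) (hX : Measurable X)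
    (hX0 : ∀ ω i, 0 ≤ X ω i) {α : ℝ} {ν : Measure (PuncturedOrthant q)}
    [IsFiniteMeasureOnCompacts ν] (h : VagueTendsto atTop (rescaledLaw P X α) ν)
    (hpos : ν (outerCone N) ≠ 0) :
    VagueTendsto atTop (fun t : ℝ => (P {ω | t < N (X ω)})⁻¹ • scaledLaw P X t)
      ((ν (outerCone N))⁻¹ • ν) := by
  have hfin := measure_outerCone_ne_top hN ν
  have hr : 0 < ν.real (outerCone N) := ENNReal.toReal_pos hpos hfin
  have h1 := (tendsto_rpow_mul_measureReal_norm_gt hN hX hX0 h).inv₀ hr.ne'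
  have := VagueTendsto.smul_of_tendsto_div (a := fun t : ℝ => (P {ω | t < N (X ω)})⁻¹) h
    (inv_nonneg.2 hr.le) (h1.congr' ?_) ?_
  · rwa [ENNReal.ofReal_inv_of_pos hr, ofReal_measureReal hfin] at this
  · filter_upwards [eventually_gt_atTop 0] with t ht
    rw [ENNReal.toReal_ofReal (Real.rpow_nonneg ht.le _), ENNReal.toReal_inv, mul_inv,
      mul_comm, div_eq_mul_inv, measureReal_def]
  · filter_upwards [eventually_gt_atTop 0] with t ht
    rw [ENNReal.toReal_ofReal (Real.rpow_nonneg ht.le _)]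
    exact (Real.rpow_pos_of_pos ht _).ne'

theorem IsHomogeneous.smul {ν : Measure (PuncturedOrthant q)} {α : ℝ} (h : IsHomogeneous ν α)
    (c : ℝ≥0∞) : IsHomogeneous (c • ν) α := fun u hu S hS => by
  rw [Measure.smul_apply, Measure.smul_apply, h u hu S hS, smul_eq_mul, smul_eq_mul,
    mul_left_comm]

/-- All side conditions follow from homogeneity of ν: infinity is null, and frontiers of dilated
cones lie in norm spheres, which are null for every t > 0. -/
theorem isIntensityMeasure_outerCone [IsFiniteMeasure P] (hN : ∀ x, N x = 0 → x = 0)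
    (hX : Measurable X)
    (hX0 : ∀ ω i, 0 ≤ X ω i) {α : ℝ} (hα : 0 < α) {ν : Measure (PuncturedOrthant q)}
    [IsFiniteMeasureOnCompacts ν] (h : VagueTendsto atTop (rescaledLaw P X α) ν)
    (hpos : ν (outerCone N) ≠ 0) :
    IsIntensityMeasure P X (outerCone N) ((ν (outerCone N))⁻¹ • ν) := by
  have hν := isHomogeneous_of_vagueTendsto hX h
  have hfin := measure_outerCone_ne_top hN ν
  refine ⟨(isOpen_outerCone hN).measurableSet, isCompact_closure_outerCone hN,
    IsFiniteMeasureOnCompacts.smul ν (ENNReal.inv_ne_top.2 hpos), fun h0 => ?_, ?_,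
    ⟨Set.Ioi 0, subset_rfl, subset_closure, fun t ht => ?_⟩, ?_⟩
  · have := congrArg (fun m : Measure (PuncturedOrthant q) => m (outerCone N)) h0
    simp [ENNReal.inv_mul_cancel hpos hfin] at this
  · rw [Measure.smul_apply, hν.infinity_null hα, smul_zero]
  · refine measure_mono_null (frontier_dilate_outerCone_subset hN ht) ?_
    rw [Measure.smul_apply, hν.measure_eq_zero (continuous_extNorm hN)
      (fun u hu x => extNorm_mul hu x) ht, smul_zero]
  · intro f hf hfs
    refine (vagueTendsto_norm_gt hN hX hX0 h hpos f hf hfs).congr' ?_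
    filter_upwards [eventually_gt_atTop 0] with t ht
    rw [scaledLaw_outerCone hN hX hX0 ht]

end Limit

/-! ### Convergence of angular laws to the spectral measure -/

section Angular

variable {Ω : Type*} [MeasurableSpace Ω] {P : Measure Ω} {q : ℕ}

/-- The direction `x / ‖x‖` of a vector in `[0,∞]^q` with finite entries. -/
noncomputable def direction (N : Seminorm ℝ (Fin q → ℝ)) (x : Fin q → ℝ≥0∞) : Fin q → ℝ :=
  (N fun i => (x i).toReal)⁻¹ • fun i => (x i).toReal

/-- The image of `ν`, restricted to `{x : ‖x‖ > 1}`, under `x ↦ x / ‖x‖`. -/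
noncomputable def angularMeasure (N : Seminorm ℝ (Fin q → ℝ)) (ν : Measure (PuncturedOrthant q)) :
    Measure (PosSphere N) :=
  ((ν.restrict (outerCone N)).map fun x => direction N x.1).comap Subtype.val

variable {N : Seminorm ℝ (Fin q → ℝ)} {X : Ω → Fin q → ℝ}

theorem isClosed_posSphere : IsClosed {x : Fin q → ℝ | (∀ i, 0 ≤ x i) ∧ N x = 1} := by
  have : {x : Fin q → ℝ | (∀ i, 0 ≤ x i) ∧ N x = 1} = (⋂ i, {x | 0 ≤ x i}) ∩ {x | N x = 1} := by
    ext x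
    simp
  rw [this]
  exact (isClosed_iInter fun i => isClosed_le continuous_const (continuous_apply i)).inter
    (isClosed_eq N.continuous_pi_fin continuous_const)

theorem inv_smul_mem_posSphere {x : Fin q → ℝ} (hx : ∀ i, 0 ≤ x i) (hN : 0 < N x) :
    (∀ i, 0 ≤ ((N x)⁻¹ • x) i) ∧ N ((N x)⁻¹ • x) = 1 := by
  refine ⟨fun i => mul_nonneg (inv_nonneg.2 hN.le) (hx i), ?_⟩
  rw [map_smul_eq_mul, norm_inv, Real.norm_of_nonneg hN.le, inv_mul_cancel₀ hN.ne']

theorem direction_mem_posSphere {x : Fin q → ℝ≥0∞} (hx : ∀ i, x i ≠ ∞) (h : 1 < extNorm N x) :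
    (∀ i, 0 ≤ direction N x i) ∧ N (direction N x) = 1 := by
  rw [extNorm_of_ne_top hx] at h
  exact inv_smul_mem_posSphere (fun i => ENNReal.toReal_nonneg)
    (ENNReal.ofReal_pos.1 (zero_lt_one.trans h))

theorem measurable_toReal_pi : Measurable fun (x : Fin q → ℝ≥0∞) i => (x i).toReal :=
  measurable_pi_lambda _ fun i => (measurable_pi_apply i).ennreal_toReal

theorem measurable_direction : Measurable (direction N) :=
  (N.continuous_pi_fin.measurable.comp measurable_toReal_pi).inv.smul measurable_toReal_pi

theorem continuousAt_direction {x : Fin q → ℝ≥0∞} (hx : ∀ i, x i ≠ ∞)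
    (h : 1 < extNorm N x) : ContinuousAt (direction N) x := by
  rw [extNorm_of_ne_top hx] at h
  have h1 := continuousAt_toReal_pi hx
  exact ((N.continuous_pi_fin.continuousAt.comp (f := fun (y : Fin q → ℝ≥0∞) i => (y i).toReal)
    h1).inv₀ (ENNReal.ofReal_pos.1 (zero_lt_one.trans h)).ne').smul h1

theorem coneOver_eq (B : Set (PosSphere N)) : coneOver N B =
    (fun x : PuncturedOrthant q => direction N x.1) ⁻¹' (Subtype.val '' B) ∩ outerCone N ∩
      {x | ∃ i, x.1 i = ∞}ᶜ := by
  ext x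
  simp only [coneOver, outerCone, direction, Set.mem_ofPred_eq, Set.mem_inter_iff,
    Set.mem_preimage, Set.mem_compl_iff, not_exists]
  tauto

theorem measurableSet_image_posSphere {B : Set (PosSphere N)} (hB : MeasurableSet B) :
    MeasurableSet (Subtype.val '' B) :=
  (MeasurableEmbedding.subtype_coe
    (isClosed_posSphere (N := N)).measurableSet).measurableSet_image' hB

theorem measurable_direction_val :
    Measurable fun x : PuncturedOrthant q => direction N x.1 :=
  measurable_direction.comp measurable_subtype_coe

theorem measurableSet_coneOver (hN : ∀ x, N x = 0 → x = 0) {B : Set (PosSphere N)}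
    (hB : MeasurableSet B) : MeasurableSet (coneOver N B) := by
  rw [coneOver_eq]
  exact ((measurable_direction_val (measurableSet_image_posSphere hB)).inter
    (isOpen_outerCone hN).measurableSet).inter measurableSet_exists_eq_top.compl

theorem angularMeasure_apply {ν : Measure (PuncturedOrthant q)}
    (hinf : ν {x | ∃ i, x.1 i = ∞} = 0) {B : Set (PosSphere N)} (hB : MeasurableSet B) :
    angularMeasure N ν B = ν (coneOver N B) := by
  have hBm := measurableSet_image_posSphere hB
  refine (comap_subtype_coe_apply (isClosed_posSphere (N := N)).measurableSet _ _).trans ?_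
  refine (Measure.map_apply measurable_direction_val hBm).trans ?_
  rw [Measure.restrict_apply (measurable_direction_val hBm), coneOver_eq]
  exact (measure_inter_conull (by rwa [compl_compl])).symm

theorem measure_coneOver_univ {ν : Measure (PuncturedOrthant q)}
    (hinf : ν {x | ∃ i, x.1 i = ∞} = 0) : ν (coneOver N Set.univ) = ν (outerCone N) := by
  rw [← measure_inter_conull (s := outerCone N) (t := {x : PuncturedOrthant q | ∃ i, x.1 i = ∞}ᶜ)
    (by rwa [compl_compl])]
  congr 1
  ext x
  rw [coneOver_eq]
  refine ⟨fun h => ⟨h.1.2, h.2⟩, fun h => ⟨⟨?_, h.1⟩, h.2⟩⟩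
  exact ⟨⟨_, direction_mem_posSphere (not_exists.1 h.2) h.1⟩, trivial, rfl⟩

/-- Almost every value of φ lies on the closed sphere, so restricting to the subtype loses no mass.
-/
theorem integral_comap_posSphere {β : Type*} [MeasurableSpace β] {m : Measure β}
    {φ : β → Fin q → ℝ} (hφ : Measurable φ) (hmem : ∀ᵐ x ∂m, (∀ i, 0 ≤ φ x i) ∧ N (φ x) = 1)
    {g : (Fin q → ℝ) → ℝ} (hg : Measurable g) :
    ∫ y : PosSphere N, g y.1 ∂((m.map φ).comap Subtype.val) = ∫ x, g (φ x) ∂m := by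
  have hS := (isClosed_posSphere (N := N)).measurableSet
  refine (integral_subtype_comap hS g).trans ?_
  have hae : ∀ᵐ y ∂m.map φ, y ∈ {x : Fin q → ℝ | (∀ i, 0 ≤ x i) ∧ N x = 1} :=
    (ae_map_iff hφ.aemeasurable hS).2 hmem
  rw [Measure.restrict_eq_self_of_ae_mem hae,
    integral_map hφ.aemeasurable hg.aestronglyMeasurable]

/-- Convergence of the angular laws, normalized by a power function. -/
theorem tendsto_rpow_mul_integral_angularLaw [IsFiniteMeasure P] (hN : ∀ x, N x = 0 → x = 0)
    (hX : Measurable X) (hX0 : ∀ ω i, 0 ≤ X ω i) {α : ℝ} (hα : 0 < α)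
    {ν : Measure (PuncturedOrthant q)}
    [IsFiniteMeasureOnCompacts ν] (h : VagueTendsto atTop (rescaledLaw P X α) ν)
    {f : PosSphere N → ℝ} (hf : Continuous f) (hfs : HasCompactSupport f) :
    Tendsto (fun t : ℝ => t ^ α * ∫ x, f x ∂(angularLaw P N X t)) atTop
      (𝓝 (∫ x, f x ∂(angularMeasure N ν))) := by
  have hν := isHomogeneous_of_vagueTendsto hX h
  have hinf := hν.infinity_null hα
  have hc := continuous_extNorm hN
  have hc' : Continuous fun x : PuncturedOrthant q => extNorm N x.1 :=
    hc.comp continuous_subtype_val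
  obtain ⟨M, hM⟩ := hfs.exists_bound_of_continuous hf
  -- A Tietze extension to ℝ^q lets the test function be composed with the direction map everywhere,
  -- including where the direction is a junk value off the sphere.
  obtain ⟨g, -, hgf⟩ := BoundedContinuousFunction.exists_extension_norm_eq_of_isClosedEmbedding
    (BoundedContinuousFunction.ofNormedAddCommGroup f hf M hM)
    (isClosed_posSphere (N := N)).isClosedEmbedding_subtypeVal
  have hgf' : ∀ x : PosSphere N, f x = g x.1 := fun x => (congrFun hgf x).symm
  simp_rw [hgf']
  have hop : IsOpen {y : Fin q → ℝ≥0∞ | 1 < extNorm N y} := isOpen_lt continuous_const hc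
  set G : (Fin q → ℝ≥0∞) → ℝ := {y | 1 < extNorm N y}.indicator fun y => g (direction N y) with hG
  have hGm : Measurable G :=
    (g.continuous.measurable.comp measurable_direction).indicator hop.measurableSet
  have hG0 : ∀ y, extNorm N y < 1 → G y = 0 := fun y hy =>
    Set.indicator_of_notMem (s := {y | 1 < extNorm N y}) (fun hy' => hy.not_gt hy') _
  have hGpos : ∀ y, 1 < extNorm N y → G y = g (direction N y) := fun y hy =>
    Set.indicator_of_mem (s := {y | 1 < extNorm N y}) hy _
  have hlim : ∫ x : PosSphere N, g x.1 ∂(angularMeasure N ν) =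
      ∫ x : PuncturedOrthant q, G x.1 ∂ν := by
    rw [angularMeasure, integral_comap_posSphere measurable_direction_val _ g.continuous.measurable,
      ← integral_indicator (isOpen_outerCone hN).measurableSet]
    · rfl
    · rw [ae_restrict_iff' (isOpen_outerCone hN).measurableSet]
      filter_upwards [measure_eq_zero_iff_ae_notMem.1 hinf] with x hx hx1
      exact direction_mem_posSphere (not_exists.1 hx) hx1
  have hpre : ∀ t : ℝ, 0 < t → ∫ x : PuncturedOrthant q, G x.1 ∂(rescaledLaw P X α t) =
      t ^ α * ∫ x : PosSphere N, g x.1 ∂(angularLaw P N X t) := by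
    intro t ht
    have hNX : Measurable fun ω => N (X ω) := N.continuous_pi_fin.measurable.comp hX
    have hT : MeasurableSet {ω | t < N (X ω)} := measurableSet_lt measurable_const hNX
    have hφ : Measurable fun ω => (N (X ω))⁻¹ • X ω := hNX.inv.smul hX
    rw [integral_rescaledLaw hX ht hGm (hG0 0 (by rw [extNorm_zero]; exact one_pos)), angularLaw,
      integral_comap_posSphere hφ _ g.continuous.measurable,
      ← integral_indicator hT]
    · congr 2
      ext ω
      by_cases hω : t < N (X ω)
      · rw [Set.indicator_of_mem (s := {ω | t < N (X ω)}) hω,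
          hGpos _ ((one_lt_extNorm_scaled hX0 ht ω).2 hω)]
        congr 1
        have h1 : (fun i => (ENNReal.ofReal (X ω i / t)).toReal) = t⁻¹ • X ω := by
          ext i
          rw [ENNReal.toReal_ofReal (div_nonneg (hX0 ω i) ht.le), div_eq_inv_mul]
          rfl
        rw [direction, h1, map_smul_eq_mul, norm_inv, Real.norm_of_nonneg ht.le, smul_smul,
          mul_inv, inv_inv, mul_right_comm, mul_inv_cancel₀ ht.ne', one_mul]
      · rw [Set.indicator_of_notMem (s := {ω | t < N (X ω)}) hω]
        exact Set.indicator_of_notMem (s := {y | 1 < extNorm N y})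
          (fun h' => hω ((one_lt_extNorm_scaled hX0 ht ω).1 h')) _
    · rw [ae_restrict_iff' hT]
      exact ae_of_all _ fun ω hω => inv_smul_mem_posSphere (hX0 ω) (ht.trans hω)
  rw [hlim]
  -- Discontinuities of G can occur only on the unit sphere, where the indicator jumps, or at
  -- infinity, where the direction is not defined.
  have hnull : ν ({x | extNorm N x.1 = 1} ∪ {x | extNorm N x.1 = ∞}) = 0 := by
    refine measure_union_null ?_ ?_
    · have := hν.measure_eq_zero hc (fun u hu x => extNorm_mul hu x) one_pos
      rwa [ENNReal.ofReal_one] at this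
    · simpa only [extNorm_eq_top] using hinf
  have key := h.tendsto_integral_of_continuousAt (g := fun x => G x.1) (M := ‖g‖)
    (hGm.comp measurable_subtype_coe)
    (hasCompactSupport_of_le_entrySum hc extNorm_zero one_pos fun x hx => hG0 _ hx)
    (fun x => by
      by_cases hx : 1 < extNorm N x.1
      · rw [hGpos _ hx]
        exact g.norm_coe_le_norm _
      · rw [hG, Set.indicator_of_notMem (s := {y | 1 < extNorm N y}) hx, abs_zero]
        exact norm_nonneg _)
    ((isClosed_eq hc' continuous_const).union (isClosed_eq hc' continuous_const)) hnull
    fun x hx => ?_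
  · exact key.congr' (by filter_upwards [eventually_gt_atTop 0] with t ht using hpre t ht)
  · rw [Set.mem_union, not_or] at hx
    have hGx : ContinuousAt G x.1 := by
      rcases lt_or_gt_of_ne hx.1 with hlt | hgt
      · refine (continuousAt_const (y := (0 : ℝ))).congr ?_
        filter_upwards [(isOpen_lt hc continuous_const).mem_nhds hlt] with y hy
        exact (hG0 y hy).symm
      · have hfin : ∀ i, x.1 i ≠ ∞ := by
          have := hx.2
          rwa [Set.mem_ofPred_eq, extNorm_eq_top, not_exists] at this
        refine (g.continuous.continuousAt.comp (continuousAt_direction hfin hgt)).congr ?_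
        filter_upwards [hop.mem_nhds hgt] with y hy
        exact (hGpos y hy).symm
    exact hGx.comp continuous_subtype_val.continuousAt

theorem vagueTendsto_angularLaw [IsFiniteMeasure P] (hN : ∀ x, N x = 0 → x = 0)
    (hX : Measurable X) (hX0 : ∀ ω i, 0 ≤ X ω i) {α : ℝ} (hα : 0 < α)
    {ν : Measure (PuncturedOrthant q)}
    [IsFiniteMeasureOnCompacts ν] (h : VagueTendsto atTop (rescaledLaw P X α) ν)
    (hpos : ν (outerCone N) ≠ 0) {u : ℝ} (hu : 0 < u) :
    VagueTendsto atTop (fun t : ℝ => (P {ω | t < N (X ω)})⁻¹ • angularLaw P N X (u * t))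
      (ENNReal.ofReal (u ^ (-α)) • (ν (outerCone N))⁻¹ • angularMeasure N ν) := by
  intro f hf hfs
  have hr : ν.real (outerCone N) ≠ 0 :=
    (ENNReal.toReal_pos hpos (measure_outerCone_ne_top hN ν)).ne'
  have h1 := (tendsto_rpow_mul_measureReal_norm_gt hN hX hX0 h).inv₀ hr
  -- Evaluating at ut brings in (ut)^α; the factor u^α is compensated by u^(-α) below.
  have h2 := (tendsto_rpow_mul_integral_angularLaw hN hX hX0 hα h hf hfs).comp
    (tendsto_id.const_mul_atTop hu)
  have h3 := (h1.mul h2).const_mul (u ^ (-α))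
  rw [integral_smul_measure, integral_smul_measure,
    ENNReal.toReal_ofReal (Real.rpow_nonneg hu.le _), ENNReal.toReal_inv, smul_eq_mul,
    smul_eq_mul]
  refine h3.congr' ?_
  filter_upwards [eventually_gt_atTop 0] with t ht
  have htα := (Real.rpow_pos_of_pos ht α).ne'
  have huα := (Real.rpow_pos_of_pos hu α).ne'
  simp only [Function.comp_apply, id]
  rw [integral_smul_measure, ENNReal.toReal_inv, smul_eq_mul, Real.mul_rpow hu.le ht.le,
    Real.rpow_neg hu.le, measureReal_def, mul_inv]
  field_simp

end Angular

/-! ### The proposition -/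

theorem proposition3p1 {Ω : Type*} [MeasurableSpace Ω] (P : Measure Ω) [IsProbabilityMeasure P]
    {d q : ℕ}
    -- norms on `ℝ^d` and `ℝ^q`
    (Nd : Seminorm ℝ (Fin d → ℝ)) (hNd : ∀ x, Nd x = 0 → x = 0)
    (Nq : Seminorm ℝ (Fin q → ℝ)) (hNq : ∀ x, Nq x = 0 → x = 0)
    -- claims with Pareto tails and intensity measure `μ`
    (V : Ω → Fin d → ℝ) (hV : Measurable V) (hV0 : ∀ ω j, 0 ≤ V ω j)
    (α : ℝ) (hα : 0 < α) (K : Fin d → ℝ) (hK : ∀ j, 0 < K j)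
    (hPareto : ∀ j, Tendsto (fun t : ℝ => P.real {ω | t < V ω j} / (K j * t ^ (-α)))
      atTop (𝓝 1))
    (μ : Measure (PuncturedOrthant d)) (hμ : IsIntensityMeasure P V (outerCone Nd) μ)
    -- a nonnegative random matrix, independent of the claims
    (A : Ω → Fin q → Fin d → ℝ) (hA : Measurable A) (hA0 : ∀ ω i j, 0 ≤ A ω i j)
    (hAV : IndepFun A V P)
    (hAmom : ∀ i j, Integrable (fun ω => A ω i j ^ α) P)
    (hAne : P {ω | A ω ≠ 0} ≠ 0)
    -- the exposures
    (F : Ω → Fin q → ℝ) (hF : ∀ ω, F ω = (Matrix.of (A ω)).mulVec (V ω)) :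
    IsRegularlyVarying P F α ∧
    0 < meanImage P A μ (outerCone Nq) ∧ meanImage P A μ (outerCone Nq) < ∞ ∧
    -- the intensity measure of `F`
    (∃ μF : Measure (PuncturedOrthant q),
      (∀ B, MeasurableSet B → μF B = (meanImage P A μ (outerCone Nq))⁻¹ * meanImage P A μ B) ∧
      IsIntensityMeasure P F (outerCone Nq) μF ∧
      VagueTendsto atTop (fun t : ℝ => (P {ω | t < Nq (F ω)})⁻¹ • scaledLaw P F t) μF ∧
      μF (outerCone Nq) = 1 ∧
      IsHomogeneous μF α) ∧
    -- the spectral measure of `F`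
    (∃ ρF : Measure (PosSphere Nq),
      (∀ B, MeasurableSet B → ρF B = (meanImage P A μ (outerCone Nq))⁻¹ * meanImage P A μ (coneOver Nq B)) ∧
      IsProbabilityMeasure ρF ∧
      ∀ u : ℝ, 0 < u →
        VagueTendsto atTop
          (fun t : ℝ => (P {ω | t < Nq (F ω)})⁻¹ • angularLaw P Nq F (u * t))
          (ENNReal.ofReal (u ^ (-α)) • ρF)) := by
  obtain rfl : F = fun ω => (Matrix.of (A ω)).mulVec (V ω) := funext hF
  have := hμ.radon
  obtain ⟨c, hc, hVc⟩ := exists_vagueTendsto_rescaledLaw hV hK hPareto hμ.ne_zero hμ.tendsto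
  have hc0 : ENNReal.ofReal c ≠ 0 := (ENNReal.ofReal_pos.2 hc).ne'
  have hνfin : IsFiniteMeasureOnCompacts (ENNReal.ofReal c • μ) :=
    IsFiniteMeasureOnCompacts.smul μ ENNReal.ofReal_ne_top
  have hν := isHomogeneous_of_vagueTendsto hV hVc
  have hFm := measurable_mulVec hA hV
  have hF0 : ∀ ω i, 0 ≤ (Matrix.of (A ω)).mulVec (V ω) i := fun ω i =>
    Finset.sum_nonneg (s := Finset.univ) (f := fun j => A ω i j * V ω j) fun j _ =>
      mul_nonneg (hA0 ω i j) (hV0 ω j)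
  have hlim := vagueTendsto_rescaledLaw_mulVec hV hV0 hα hK hPareto hVc hA hA0 hAV hAmom
  have hmfin := isFiniteMeasureOnCompacts_meanMeasure hα hν hA hA0 hAmom
  have hpos := meanMeasure_outerCone_ne_zero hν
    (measure_coord_gt_one_ne_zero hV hK hPareto hVc) hA hA0 hAne hNq
  set m := meanMeasure P A (ENNReal.ofReal c • μ) with hm
  -- Homogeneity of the mean measure is read off from its being a limit under power normalization.
  have hmhom := isHomogeneous_of_vagueTendsto hFm hlim
  have hinf := hmhom.infinity_null hα
  have hmtop := measure_outerCone_ne_top hNq m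
  have happly : ∀ B, MeasurableSet B → m B = ENNReal.ofReal c * meanImage P A μ B := by
    intro B hB
    rw [hm, meanMeasure_apply hA hB, meanImage, meanImage,
      ← lintegral_const_mul' _ _ ENNReal.ofReal_ne_top]
    rfl
  have hCm := (isOpen_outerCone hNq).measurableSet
  -- The unknown constant c cancels, so normalizing with cμ or with μ gives the same measure.
  have hratio : ∀ B, MeasurableSet B → (m (outerCone Nq))⁻¹ * m B =
      (meanImage P A μ (outerCone Nq))⁻¹ * meanImage P A μ B := by
    intro B hB
    rw [happly B hB, happly _ hCm, ENNReal.mul_inv (.inl hc0) (.inl ENNReal.ofReal_ne_top),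
      mul_mul_mul_comm, ENNReal.inv_mul_cancel hc0 ENNReal.ofReal_ne_top, one_mul]
  have hint := isIntensityMeasure_outerCone hNq hFm hF0 hα hlim hpos
  refine ⟨⟨hα, outerCone Nq, _, hint, hmhom.smul _⟩, ?_, ?_,
    ⟨(m (outerCone Nq))⁻¹ • m, hratio, hint, vagueTendsto_norm_gt hNq hFm hF0 hlim hpos,
      ENNReal.inv_mul_cancel hpos hmtop, hmhom.smul _⟩,
    ⟨(m (outerCone Nq))⁻¹ • angularMeasure Nq m, fun B hB => ?_, ⟨?_⟩, fun u hu =>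
      vagueTendsto_angularLaw hNq hFm hF0 hα hlim hpos hu⟩⟩
  · rw [happly _ hCm] at hpos
    exact pos_iff_ne_zero.2 (right_ne_zero_of_mul hpos)
  · rw [happly _ hCm] at hmtop
    exact lt_top_iff_ne_top.2 fun h => hmtop (by rw [h, ENNReal.mul_top hc0])
  · rw [Measure.smul_apply, smul_eq_mul, angularMeasure_apply hinf hB]
    exact hratio _ (measurableSet_coneOver hNq hB)
  · rw [Measure.smul_apply, smul_eq_mul, angularMeasure_apply hinf MeasurableSet.univ,
      measure_coneOver_univ hinf, ENNReal.inv_mul_cancel hpos hmtop]
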